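/- A Stable Roommates (SR) instance $\mathcal I=(A,(\succ_a)_{a\in A})$ consists of a finite set $A$ of agents, $|A|$ even, and, for each agent $a\in A$, a total order (preference order) $\succ_a$ on $A\setminus\{a\}$. For a total order $\succ$ on a finite set $X$ let $\mathrm{pos}_\succ(x)$ be one plus the number of elements preferred to $x$, and for two total orders $\succ,\succ'$ on $X$ let $\mathrm{spear}(\succ,\succ')=\sum_{x\in X}|\mathrm{pos}_\succ(x)-\mathrm{pos}_{\succ'}(x)|$. For SR instances $\mathcal I=(A,(\succ_a)_{a\in A})$ and $\mathcal I'=(A',(\succ_{a'})_{a'\in A'})$ with $|A|=|A'|$ define $$d_{\mathrm{spear}}(\mathcal I,\mathcal I')=\min_{\sigma}\ \sum_{a\in A}\mathrm{spear}\bigl(\sigma(\succ_a),\succ_{\sigma(a)}\bigr),$$ where $\sigma$ ranges over all bijections $A\to A'$ and $\sigma(\succ_a)$ is the order on $A'\setminus\{\sigma(a)\}$ obtained from $\succ_a$ by replacing each agent $b$ by $\sigma(b)$. Proposition. There is no polynomial-time algorithm (Turing machine) that, given two SR instances with the same even number of agents (as lists of preference lists), computes $d_{\mathrm{spear}}$ (written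 in binary), unless the Graph Isomorphism problem (given two finite simple graphs $G=(V,E)$ and $G'=(V',E')$ with $|V|=|V'|$, by their adjacency matrices, is there a bijection $\mu:V\to V'$ such that $\{v,w\}\in E$ if and only if $\{\mu(v),\mu(w)\}\in E'$?) is in P. In particular, there is no such algorithm for instances with arbitrary numbers of agents either, unless Graph Isomorphism is in P. -/

import Mathlib

namespace StableRoommates

/-! ### Preference orders

A preference order over a finite set `X` is a linear order on `X`; `x < y` in it means that
`x` is preferred to `y`. -/

/-- The position of `x` in a preference order: one plus the number of elements preferred to `x`. -/
def pos {X : Type*} [Fintype X] (L : LinearOrder X) (x : X) : ℕ :=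
  letI := L
  (Finset.univ.filter fun y : X => y < x).card + 1

/-- The elements of `X`, listed from most to least preferred. -/
def ranking {X : Type*} [Fintype X] (L : LinearOrder X) : List X :=
  letI := L
  (Finset.univ : Finset X).sort (· ≤ ·)

/-- The Spearman distance `∑ x, |pos L x - pos L' x|` of two preference orders over `X`. -/
def spear {X : Type*} [Fintype X] (L L' : LinearOrder X) : ℕ :=
  ∑ x : X, ((pos L x : ℤ) - (pos L' x : ℤ)).natAbs

/-- The preference order over `Y` that arises from one over `X` by replacing every `x` by `e x`. -/
@[reducible]
def relabel {X Y : Type*} (e : X ≃ Y) (L : LinearOrder X) : LinearOrder Y :=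
  letI := L
  LinearOrder.lift' e.symm e.symm.injective

/-! ### Stable Roommates instances and their Spearman distance -/

/-- A Stable Roommates instance with agent set `A`: every agent has a preference order over all
other agents. -/
structure SRInstance (A : Type*) where
  pref : (a : A) → LinearOrder {b : A // b ≠ a}

/-- The bijection `A ∖ {a} ≃ A' ∖ {σ a}` induced by a bijection `σ : A ≃ A'`. -/
def othersEquiv {A A' : Type*} (σ : A ≃ A') (a : A) : {b : A // b ≠ a} ≃ {b : A' // b ≠ σ a} :=
  σ.subtypeEquiv fun _ => (not_congr σ.apply_eq_iff_eq).symm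

/-- The cost `∑ a, spear (σ(≻_a), ≻_{σ(a)})` of a bijection `σ` between the agent sets. -/
def spearCost {A A' : Type*} [Fintype A] [Fintype A'] [DecidableEq A']
    (I : SRInstance A) (I' : SRInstance A') (σ : A ≃ A') : ℕ :=
  ∑ a : A, spear (relabel (othersEquiv σ a) (I.pref a)) (I'.pref (σ a))

/-- The distance `d_spear` of two instances with equally many agents: the minimum of the cost over
all bijections between the agent sets. -/
noncomputable def dSpear {A A' : Type*} [Fintype A] [Fintype A'] [DecidableEq A']
    (I : SRInstance A) (I' : SRInstance A') : ℕ :=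
  ⨅ σ : A ≃ A', spearCost I I' σ

/-- For equally many agents the infimum in `dSpear` is a minimum. -/
theorem exists_spearCost_eq_dSpear {A A' : Type*} [Fintype A] [Fintype A'] [DecidableEq A']
    (h : Fintype.card A = Fintype.card A') (I : SRInstance A) (I' : SRInstance A') :
    ∃ σ : A ≃ A', spearCost I I' σ = dSpear I I' := by
  have : Nonempty (A ≃ A') := ⟨Fintype.equivOfCardEq h⟩
  exact Nat.sInf_mem (Set.range_nonempty (spearCost I I'))

theorem dSpear_le_spearCost {A A' : Type*} [Fintype A] [Fintype A'] [DecidableEq A']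
    (I : SRInstance A) (I' : SRInstance A') (σ : A ≃ A') : dSpear I I' ≤ spearCost I I' σ :=
  Nat.sInf_le ⟨σ, rfl⟩

/-! ### Inputs of the two computational problems, as bit strings -/

/-- A pair of Stable Roommates instances with the same even number `n` of agents `0, …, n - 1`. -/
structure SRPair where
  n : ℕ
  even_n : Even n
  I : SRInstance (Fin n)
  I' : SRInstance (Fin n)

/-- The value to be computed on input `(I, I')`. -/
noncomputable def SRPair.distance (p : SRPair) : ℕ :=
  dSpear p.I p.I'

/-- A self-delimiting code of a natural number: `k` ones and a zero.  It is only used for numbers of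
agents or vertices and for names of agents, so that the length of an input stays polynomial in the
number of agents or vertices. -/
def unary (k : ℕ) : List Bool :=
  List.replicate k true ++ [false]

/-- The agents other than `a`, listed from most to least preferred by `a`. -/
def SRInstance.prefList {n : ℕ} (I : SRInstance (Fin n)) (a : Fin n) : List {b : Fin n // b ≠ a} :=
  ranking (I.pref a)

/-- The preference lists of the agents `0, …, n - 1`, one after the other. -/
def SRInstance.encode {n : ℕ} (I : SRInstance (Fin n)) : List Bool :=
  (List.finRange n).flatMap fun a => (I.prefList a).flatMap fun b => unary (b : Fin n)

/-- The number of agents and the two instances. -/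
def SRPair.encode (p : SRPair) : List Bool :=
  unary p.n ++ p.I.encode ++ p.I'.encode

/-- An input of Graph Isomorphism: two simple graphs with the same number `n` of
vertices `0, …, n - 1`. -/
structure GraphPair where
  n : ℕ
  G : SimpleGraph (Fin n)
  G' : SimpleGraph (Fin n)

open Classical in
/-- The adjacency matrix of a graph, row by row. -/
noncomputable def encodeGraph {n : ℕ} (G : SimpleGraph (Fin n)) : List Bool :=
  (List.finRange n).flatMap fun u => (List.finRange n).map fun v => decide (G.Adj u v)

/-- The number of vertices and the two adjacency matrices. -/
noncomputable def GraphPair.encode (p : GraphPair) : List Bool :=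
  unary p.n ++ encodeGraph p.G ++ encodeGraph p.G'

open Classical in
/-- The answer to the Graph Isomorphism question. -/
noncomputable def GraphPair.isomorphic (p : GraphPair) : Bool :=
  decide (Nonempty (p.G ≃g p.G'))

/-! ### Polynomial time -/

/-- `f` is computed by a (multi-stack) Turing machine whose number of steps is bounded by a
polynomial in the length of the encoded input. -/
def PolyTimeComputable {α β : Type} (ea : α → List Bool) (eb : β → List Bool) (f : α → β) : Prop :=
  Nonempty (Turing.TM2ComputableInPolyTime ea eb f)

/-- A polynomial-time algorithm exists that computes `d_spear`, written in binary. -/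
def DSpearInPolyTime : Prop :=
  PolyTimeComputable SRPair.encode Computability.encodeNat SRPair.distance

/-- Graph Isomorphism is in P. -/
def GraphIsomorphismInP : Prop :=
  PolyTimeComputable GraphPair.encode Computability.encodeBool GraphPair.isomorphic

end StableRoommates

/-!
A polynomial-time algorithm for `d_spear` yields one for Graph Isomorphism, by a reduction that
asks for a single distance.

*The instances.* Let `s = 2 * n ^ 2 + 1`.  To the vertices of a graph on `0, …, n - 1` one adds
`M = 3 * s * n` dummies.  A vertex ranks its neighbours first, then all dummies in a fixed order,
then the other vertices.  The dummies rank the other dummies in the same fixed order; a third of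
them puts the vertices in front of the dummies, the others put them behind
(`vertexRow`, `dummyRow`).  In the first instance all dummies rank the vertices in increasing
order; in the second one the `i`-th dummy uses the cyclic order that starts with `i % n`
(`rotation`).

*The distance.* Averaged over all rotations, a vertex takes every position equally often.  Hence,
however the vertices are matched, the dummies disagree about them by the same amount
`s * (n ^ 3 - n)` (`sum_rank_sub`).  An isomorphism, with all dummies fixed, costs at most `n ^ 3` more
(`cost_sumCongr_one_le`), which stays below the threshold `s * n ^ 3 + 1`.  Conversely, a matching
that sends a vertex to a dummy costs more than that, since some of the dummies rank the vertices
first and some last (`le_cost_of_inl_eq_inr`).  Otherwise dummies are matched with dummies;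
interchanging them does not save any cost, because the sum of the positions of the `i`-th dummy in
the lists of all dummies grows with `i` by more than what can be saved (`le_sum_column`).
Finally, a pair of vertices that is adjacent on one side only costs more than `M - n`.  So the
graphs are isomorphic if and only if the distance is below the threshold (`exists_cost_lt_iff`,
`dSpear_lt_threshold_iff`).

*The machine.* Polynomial-time computability refers to multi-stack machines.  Programs for them are
written in a small language with loops over stacks and oracle questions.  In a terminating run each
loop iteration shortens the stack that the loop is controlled by, so the number of steps is
polynomial in a bound on the stacks that occur.  Such a program is compiled to a machine in which
the given machine for `d_spear` serves as a subroutine (`polyTimeComputable_of_runs`).  The program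
`isoCmd` writes the two instances, asks for their distance and compares the answer with the
threshold (`runs_isoCmd`).
-/

namespace StableRoommates

open Turing StateTransition Function

/-! ### Programs with an oracle -/

/-- Programs over registers `r : R`, each of which holds a stack of bits.  `read r c₁ c₀` pops a bit
and branches on it (and does nothing if there is none); `loop r p c` runs `c` as long as `p` holds
of the top of `r`; `query r` replaces the content of `r` by the answer of an oracle. -/
inductive Cmd (R : Type) : Type
  | skip : Cmd R
  | push (r : R) (b : Bool) : Cmd R
  | read (r : R) (c₁ c₀ : Cmd R) : Cmd R
  | seq (c d : Cmd R) : Cmd R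
  | loop (r : R) (p : Option Bool → Bool) (c : Cmd R) : Cmd R
  | query (r : R) : Cmd R

infixr:60 " ;; " => Cmd.seq

/-- Big-step semantics.  `Runs Q B c s s'`: from the register contents `s`, the program `c` ends
with `s'`, where `Q x y` means that the oracle may answer `x` by `y`.  Every iteration of a loop
has to shorten its register, and the registers that are looped over or queried have length at
most `B`; so the running time is bounded by a polynomial in `B` that depends on `c` only.
Questions and answers are stored in reverse, as popping them from one stack and pushing them
onto another reverses them. -/
inductive Runs {R : Type} [DecidableEq R] (Q : List Bool → List Bool → Prop) (B : ℕ) :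
    Cmd R → (R → List Bool) → (R → List Bool) → Prop
  | skip (s) : Runs Q B .skip s s
  | push (r b s) : Runs Q B (.push r b) s (update s r (b :: s r))
  | read_nil {r c₁ c₀ s} : s r = [] → Runs Q B (.read r c₁ c₀) s s
  | read_cons {r c₁ c₀ s s' b l} : s r = b :: l → Runs Q B (cond b c₁ c₀) (update s r l) s' →
      Runs Q B (.read r c₁ c₀) s s'
  | seq {c d s s' s''} : Runs Q B c s s' → Runs Q B d s' s'' → Runs Q B (.seq c d) s s''
  | loop_exit {r p c s} : p (s r).head? = false → Runs Q B (.loop r p c) s s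
  | loop_step {r p c s s' s''} : p (s r).head? = true → (s r).length ≤ B → Runs Q B c s s' →
      (s' r).length < (s r).length → Runs Q B (.loop r p c) s' s'' → Runs Q B (.loop r p c) s s''
  | query {r s x y} : Q x y → s r = x.reverse → x.length ≤ B → y.length ≤ B →
      Runs Q B (.query r) s (update s r y.reverse)

/-! ### Counting steps -/

/-- `f` leads from `a` to `b` in exactly `n` steps. -/
inductive StepsIn {α : Type} (f : α → Option α) : ℕ → α → α → Prop
  | refl (a) : StepsIn f 0 a a
  | head {n a b c} : f a = some b → StepsIn f n b c → StepsIn f (n + 1) a c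

theorem StepsIn.trans {α : Type} {f : α → Option α} {m n a b c} (h₁ : StepsIn f m a b)
    (h₂ : StepsIn f n b c) : StepsIn f (m + n) a c := by
  induction h₁ with
  | refl a => simpa using h₂
  | head h _ ih => rw [Nat.add_right_comm]; exact .head h (ih h₂)

theorem iterate_bind_none {α : Type} (f : α → Option α) (n : ℕ) :
    (flip bind f)^[n] none = none := by
  induction n with
  | zero => rfl
  | succ n ih => rw [iterate_succ_apply]; exact ih

theorem stepsIn_iff {α : Type} {f : α → Option α} {n a b} :
    StepsIn f n a b ↔ (flip bind f)^[n] (some a) = some b := by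
  induction n generalizing a with
  | zero =>
    refine ⟨fun h => by cases h; rfl, fun h => ?_⟩
    cases h
    exact .refl _
  | succ n ih =>
    rw [iterate_succ_apply, show flip bind f (some a) = f a from rfl]
    constructor
    · rintro (_ | ⟨h, h'⟩)
      rw [h]; exact ih.1 h'
    · intro h
      rcases hf : f a with _ | c
      · rw [hf, iterate_bind_none] at h; cases h
      · rw [hf] at h; exact .head hf (ih.2 h)

/-! ### Compilation of oracle programs to stack machines -/

section Compile

variable {R : Type} (h : TM2ComputableAux Bool Bool)

/-- The labels of the machine code of a program.  In the code of a loop or a branching, `none` is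
the test; in that of a query, `Sum.inl false` transfers the question to the oracle machine and
`Sum.inl true` transfers the answer back. -/
def Lab : Cmd R → Type
  | .skip => Unit
  | .push _ _ => Unit
  | .read _ c₁ c₀ => Option (Lab c₁ ⊕ Lab c₀)
  | .seq c d => Lab c ⊕ Lab d
  | .loop _ _ c => Option (Lab c)
  | .query _ => Bool ⊕ h.tm.Λ

@[reducible]
def Lab.fintype : (c : Cmd R) → Fintype (Lab h c)
  | .skip => inferInstanceAs (Fintype Unit)
  | .push _ _ => inferInstanceAs (Fintype Unit)
  | .read _ c₁ c₀ =>
    letI := Lab.fintype c₁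
    letI := Lab.fintype c₀
    inferInstanceAs (Fintype (Option (Lab h c₁ ⊕ Lab h c₀)))
  | .seq c d =>
    letI := Lab.fintype c
    letI := Lab.fintype d
    inferInstanceAs (Fintype (Lab h c ⊕ Lab h d))
  | .loop _ _ c =>
    letI := Lab.fintype c
    inferInstanceAs (Fintype (Option (Lab h c)))
  | .query _ =>
    letI := h.tm.ΛFin
    inferInstanceAs (Fintype (Bool ⊕ h.tm.Λ))

/-- The label at which the code of a program starts. -/
def entry : (c : Cmd R) → Lab h c
  | .skip => ()
  | .push _ _ => ()
  | .read _ _ _ => none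
  | .seq c _ => Sum.inl (entry c)
  | .loop _ _ _ => none
  | .query _ => Sum.inl false

/-- The alphabets: bits for the registers, next to the stacks of the oracle machine. -/
abbrev Alph : R ⊕ h.tm.K → Type
  | .inl _ => Bool
  | .inr k => h.tm.Γ k

/-- The internal state: a scratch bit, next to the state of the oracle machine. -/
abbrev Var : Type := Option Bool × h.tm.σ

/-- The code of a statement of the oracle machine, with halting replaced by a jump. -/
def embedStmt {Λ : Type} (emb : h.tm.Λ → Λ) (exit : Λ) :
    TM2.Stmt h.tm.Γ h.tm.Λ h.tm.σ → TM2.Stmt (Alph (R := R) h) Λ (Var h)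
  | .push k f q => .push (Sum.inr k) (fun v => f v.2) (embedStmt emb exit q)
  | .peek k f q => .peek (Sum.inr k) (fun v o => (v.1, f v.2 o)) (embedStmt emb exit q)
  | .pop k f q => .pop (Sum.inr k) (fun v o => (v.1, f v.2 o)) (embedStmt emb exit q)
  | .load f q => .load (fun v => (v.1, f v.2)) (embedStmt emb exit q)
  | .branch f q₁ q₂ => .branch (fun v => f v.2) (embedStmt emb exit q₁) (embedStmt emb exit q₂)
  | .goto f => .goto fun v => emb (f v.2)
  | .halt => .goto fun _ => exit

/-- Clear the scratch bit and jump. -/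
def jump {Λ : Type} (l : Λ) : TM2.Stmt (Alph (R := R) h) Λ (Var h) :=
  .load (fun v => (none, v.2)) (.goto fun _ => l)

/-- The code of a program whose labels are embedded by `emb`, and which continues at `exit`. -/
def code {Λ : Type} : (c : Cmd R) → (Lab h c → Λ) → Λ → Lab h c →
    TM2.Stmt (Alph (R := R) h) Λ (Var h)
  | .skip, _, exit, _ => jump h exit
  | .push r b, _, exit, _ => .push (Sum.inl r) (fun _ => b) (jump h exit)
  | .read r c₁ c₀, emb, exit, none =>
    .pop (Sum.inl r) (fun v o => (o, v.2)) <|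
      .branch (fun v => v.1 == some true) (jump h (emb (some (.inl (entry h c₁))))) <|
      .branch (fun v => v.1 == some false) (jump h (emb (some (.inr (entry h c₀))))) (jump h exit)
  | .read _ c₁ _, emb, exit, some (.inl l) => code c₁ (fun l => emb (some (.inl l))) exit l
  | .read _ _ c₀, emb, exit, some (.inr l) => code c₀ (fun l => emb (some (.inr l))) exit l
  | .seq c d, emb, _, .inl l => code c (fun l => emb (.inl l)) (emb (.inr (entry h d))) l
  | .seq _ d, emb, exit, .inr l => code d (fun l => emb (.inr l)) exit l
  | .loop r p c, emb, exit, none =>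
    .peek (Sum.inl r) (fun v o => (o, v.2)) <|
      .branch (fun v => p v.1) (jump h (emb (some (entry h c)))) (jump h exit)
  | .loop _ _ c, emb, _, some l => code c (fun l => emb (some l)) (emb none) l
  | .query r, emb, _, .inl false =>
    .pop (Sum.inl r) (fun v o => (o, v.2)) <|
      .branch (fun v => v.1.isSome)
        (.push (Sum.inr h.tm.k₀) (fun v => h.inputAlphabet.symm (v.1.getD false))
          (jump h (emb (.inl false))))
        (jump h (emb (.inr h.tm.main)))
  | .query r, emb, exit, .inl true =>
    .pop (Sum.inr h.tm.k₁) (fun v o => (o.map h.outputAlphabet, v.2)) <|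
      .branch (fun v => v.1.isSome)
        (.push (Sum.inl r) (fun v => v.1.getD false) (jump h (emb (.inl true))))
        (jump h exit)
  | .query _, emb, _, .inr l => embedStmt h (fun l => emb (.inr l)) (emb (.inl true)) (h.tm.m l)

/-- The stacks of the compiled machine. -/
def join (s : R → List Bool) (S : ∀ k, List (h.tm.Γ k)) : ∀ k, List (Alph (R := R) h k)
  | .inl r => s r
  | .inr k => S k

variable [DecidableEq R]

@[simp] theorem update_join_inl (s : R → List Bool) (S : ∀ k, List (h.tm.Γ k)) (r : R)
    (l : List Bool) : update (join h s S) (Sum.inl r) l = join h (update s r l) S := by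
  funext k
  rcases k with r' | k
  · by_cases hr : r' = r
    · subst hr; simp [join]
    · rw [update_of_ne (by simpa using hr)]; simp [join, hr]
  · rw [update_of_ne (by simp)]; rfl

@[simp] theorem update_join_inr (s : R → List Bool) (S : ∀ k, List (h.tm.Γ k)) (k : h.tm.K)
    (l : List (h.tm.Γ k)) : update (join h s S) (Sum.inr k) l = join h s (update S k l) := by
  funext k'
  rcases k' with r' | k'
  · rw [update_of_ne (by simp)]; rfl
  · by_cases hr : k' = k
    · subst hr; simp [join]
    · rw [update_of_ne (by simpa using hr)]; simp [join, hr]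

theorem update_nil_inl (r : R) (l : List Bool) :
    update (fun _ => [] : ∀ k, List (Alph h k)) (Sum.inl r) l =
      join h (update (fun _ => []) r l) fun _ => [] := by
  rw [← update_join_inl]
  congr 1
  funext k
  cases k <;> rfl

/-- The configuration of the compiled machine during a call of the oracle machine. -/
def embedCfg {Λ : Type} (emb : h.tm.Λ → Λ) (exit : Λ) (s : R → List Bool) (a : h.tm.Cfg) :
    TM2.Cfg (Alph (R := R) h) Λ (Var h) :=
  ⟨some (a.l.elim exit emb), (none, a.var), join h s a.stk⟩

theorem stepAux_embedStmt {Λ : Type} (emb : h.tm.Λ → Λ) (exit : Λ) (s : R → List Bool)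
    (q : TM2.Stmt h.tm.Γ h.tm.Λ h.tm.σ) (v : h.tm.σ) (S : ∀ k, List (h.tm.Γ k)) :
    TM2.stepAux (embedStmt h emb exit q) (none, v) (join h s S) =
      embedCfg h emb exit s (TM2.stepAux q v S) := by
  induction q generalizing v S with
  | push k f q ih => simpa [embedStmt, join] using ih _ _
  | peek k f q ih => simpa [embedStmt, join] using ih _ _
  | pop k f q ih => simpa [embedStmt, join] using ih _ _
  | load f q ih => simpa [embedStmt] using ih _ _
  | branch f q₁ q₂ ih₁ ih₂ =>
    simp only [embedStmt, TM2.stepAux]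
    cases f v
    · exact ih₂ _ _
    · exact ih₁ _ _
  | goto f => rfl
  | halt => rfl

theorem stepsIn_embedCfg {Λ : Type} {M : Λ → TM2.Stmt (Alph (R := R) h) Λ (Var h)}
    {emb : h.tm.Λ → Λ} {exit : Λ} (hM : ∀ l, M (emb l) = embedStmt h emb exit (h.tm.m l))
    (s : R → List Bool) {n : ℕ} {a b : h.tm.Cfg} (hab : StepsIn h.tm.step n a b) :
    StepsIn (TM2.step M) n (embedCfg h emb exit s a) (embedCfg h emb exit s b) := by
  induction hab with
  | refl a => exact .refl _
  | @head n a b c hs _ ih =>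
    refine .head ?_ ih
    rcases a with ⟨_ | l, v, S⟩
    · cases hs
    · cases hs
      simp only [embedCfg, Option.elim_some, TM2.step, hM]
      rw [stepAux_embedStmt]
      rfl

/-- The configuration of the compiled machine between two commands.  All stacks of the oracle
machine are empty and its state is initial, so that the oracle can be asked again. -/
def idle {Λ : Type} (l : Λ) (s : R → List Bool) : TM2.Cfg (Alph (R := R) h) Λ (Var h) :=
  ⟨some l, (none, h.tm.initialState), join h s fun _ => []⟩

/-- Transferring a register to the input stack of the oracle machine. -/
theorem stepsIn_transfer_in {Λ : Type} {M : Λ → TM2.Stmt (Alph (R := R) h) Λ (Var h)} {r : R}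
    {emb : Lab h (.query r) → Λ} {exit : Λ} (hM : ∀ l, M (emb l) = code h (.query r) emb exit l)
    (x : List Bool) (s : R → List Bool) (hs : s r = x) (l : List (h.tm.Γ h.tm.k₀)) :
    StepsIn (TM2.step M) (x.length + 1)
      ⟨some (emb (.inl false)), (none, h.tm.initialState),
        join h s (update (fun _ => []) h.tm.k₀ l)⟩
      ⟨some (emb (.inr h.tm.main)), (none, h.tm.initialState),
        join h (update s r []) (update (fun _ => []) h.tm.k₀
          ((x.map h.inputAlphabet.symm).reverse ++ l))⟩ := by
  have e := hM (Sum.inl false)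
  induction x generalizing s l with
  | nil =>
    refine .head ?_ (.refl _)
    simp [TM2.step, e, code, jump, join, hs]
  | cons b x ih =>
    have := ih (update s r x) (by simp) (h.inputAlphabet.symm b :: l)
    refine .head ?_ (by simpa using this)
    simp [TM2.step, e, code, jump, join, hs]

/-- Transferring the output stack of the oracle machine to a register. -/
theorem stepsIn_transfer_out {Λ : Type} {M : Λ → TM2.Stmt (Alph (R := R) h) Λ (Var h)} {r : R}
    {emb : Lab h (.query r) → Λ} {exit : Λ} (hM : ∀ l, M (emb l) = code h (.query r) emb exit l)
    (y : List Bool) (s : R → List Bool) :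
    StepsIn (TM2.step M) (y.length + 1)
      ⟨some (emb (.inl true)), (none, h.tm.initialState),
        join h s (update (fun _ => []) h.tm.k₁ (y.map h.outputAlphabet.symm))⟩
      (idle h exit (update s r (y.reverse ++ s r))) := by
  have e := hM (Sum.inl true)
  induction y generalizing s with
  | nil =>
    refine .head ?_ (.refl _)
    simp [TM2.step, e, code, jump, join, idle]
  | cons b y ih =>
    have := ih (update s r (b :: s r))
    refine .head ?_ (by simpa using this)
    simp [TM2.step, e, code, jump, join]

theorem initList_eq (tm : FinTM2) (l : List (tm.Γ tm.k₀)) :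
    initList tm l = ⟨some tm.main, tm.initialState, update (fun _ => []) tm.k₀ l⟩ := by
  simp only [initList]
  congr 1
  funext k
  by_cases hk : k = tm.k₀
  · subst hk; simp
  · simp [hk]

theorem haltList_eq (tm : FinTM2) (l : List (tm.Γ tm.k₁)) :
    haltList tm l = ⟨none, tm.initialState, update (fun _ => []) tm.k₁ l⟩ := by
  simp only [haltList]
  congr 1
  funext k
  by_cases hk : k = tm.k₁
  · subst hk; simp
  · simp [hk]

/-- The word function computed by the oracle machine within the time bound `time`. -/
def OracleSpec (time : Polynomial ℕ) (x y : List Bool) : Prop :=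
  Nonempty (TM2OutputsInTime h.tm (x.map h.inputAlphabet.invFun)
    (some (y.map h.outputAlphabet.invFun)) (time.eval x.length))

/-- A bound for the running time of the code of a program, in terms of the bound `B` of `Runs`. -/
noncomputable def timeBound (time : Polynomial ℕ) : Cmd R → Polynomial ℕ
  | .skip => 1
  | .push _ _ => 1
  | .read _ c₁ c₀ => 1 + (timeBound time c₁ + timeBound time c₀)
  | .seq c d => timeBound time c + timeBound time d
  | .loop _ _ c => 1 + Polynomial.X * (1 + timeBound time c)
  | .query _ => (Polynomial.X + 1) + (time + (Polynomial.X + 1))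

theorem eval_mono (p : Polynomial ℕ) {m n : ℕ} (hmn : m ≤ n) : p.eval m ≤ p.eval n := by
  rw [Polynomial.eval_eq_sum_range, Polynomial.eval_eq_sum_range]
  gcongr

/-- The compiled code simulates the program.  The last part of the conclusion is the invariant for
loops: the length of the loop register bounds the number of iterations that are left. -/
theorem stepsIn_code {Q : List Bool → List Bool → Prop} {time : Polynomial ℕ}
    (hQ : ∀ x y, Q x y → OracleSpec h time x y) {B : ℕ}
    {Λ : Type} {M : Λ → TM2.Stmt (Alph (R := R) h) Λ (Var h)}
    {c : Cmd R} {s s' : R → List Bool} (hc : Runs Q B c s s')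
    (emb : Lab h c → Λ) (exit : Λ) (hM : ∀ l, M (emb l) = code h c emb exit l) :
    ∃ t, StepsIn (TM2.step M) t (idle h (emb (entry h c)) s) (idle h exit s') ∧
      t ≤ (timeBound time c).eval B ∧
      ∀ r p d, c = .loop r p d → t ≤ 1 + (s r).length * (1 + (timeBound time d).eval B) := by
  induction hc generalizing exit with
  | skip s =>
    have e := hM ()
    refine ⟨1, .head ?_ (.refl _), by simp [timeBound], by rintro _ _ _ ⟨⟩⟩
    simp [TM2.step, idle, e, entry, code, jump]
  | push r b s =>
    have e := hM ()
    refine ⟨1, .head ?_ (.refl _), by simp [timeBound], by rintro _ _ _ ⟨⟩⟩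
    simp [TM2.step, idle, e, entry, code, jump, join]
  | @read_nil r c₁ c₀ s hs =>
    have e := hM none
    refine ⟨1, .head ?_ (.refl _), by simp [timeBound], by rintro _ _ _ ⟨⟩⟩
    rw [show s = update s r [] by rw [← hs, update_eq_self]]
    simp [TM2.step, idle, e, entry, code, jump, join]
  | @read_cons r c₁ c₀ s s' b l hs _ ih =>
    have e := hM none
    cases b with
    | true =>
      obtain ⟨t, ht, htb, -⟩ := ih (fun l => emb (some (.inl l))) exit fun l => hM (some (.inl l))
      refine ⟨t + 1, .head ?_ ht, by simp [timeBound] at htb ⊢; omega, by rintro _ _ _ ⟨⟩⟩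
      simp [TM2.step, idle, e, entry, code, jump, join, hs]
    | false =>
      obtain ⟨t, ht, htb, -⟩ := ih (fun l => emb (some (.inr l))) exit fun l => hM (some (.inr l))
      refine ⟨t + 1, .head ?_ ht, by simp [timeBound] at htb ⊢; omega, by rintro _ _ _ ⟨⟩⟩
      simp [TM2.step, idle, e, entry, code, jump, join, hs]
  | @seq c d s s' s'' _ _ ih₁ ih₂ =>
    obtain ⟨t₁, ht₁, hb₁, -⟩ := ih₁ (fun l => emb (.inl l)) (emb (.inr (entry h d)))
      fun l => hM (.inl l)
    obtain ⟨t₂, ht₂, hb₂, -⟩ := ih₂ (fun l => emb (.inr l)) exit fun l => hM (.inr l)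
    exact ⟨t₁ + t₂, ht₁.trans ht₂, by simp [timeBound]; omega, by rintro _ _ _ ⟨⟩⟩
  | @loop_exit r p c s hp =>
    have e := hM none
    refine ⟨1, .head ?_ (.refl _), by simp [timeBound], by omega⟩
    simp [TM2.step, idle, e, entry, code, jump, join, hp]
  | @loop_step r p c s s' s'' hp hB _ hlt _ ih₁ ih₂ =>
    have e := hM none
    obtain ⟨t₁, ht₁, hb₁, -⟩ := ih₁ (fun l => emb (some l)) (emb none) fun l => hM (some l)
    obtain ⟨t₂, ht₂, -, hb₂⟩ := ih₂ emb exit hM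
    have h₂ := hb₂ r p c rfl
    have h₃ : 1 + t₁ + t₂ ≤ 1 + (s r).length * (1 + (timeBound time c).eval B) := by
      have : (s' r).length + 1 ≤ (s r).length := hlt
      have := Nat.mul_le_mul_right (1 + (timeBound time c).eval B) this
      rw [Nat.add_mul] at this
      omega
    refine ⟨1 + t₁ + t₂, ?_, ?_, ?_⟩
    · rw [Nat.add_right_comm, Nat.add_assoc, Nat.add_comm]
      refine .head ?_ (by rw [Nat.add_comm]; exact ht₁.trans ht₂)
      simp [TM2.step, idle, e, entry, code, jump, join, hp]
    · refine h₃.trans ?_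
      simp only [timeBound, Polynomial.eval_add, Polynomial.eval_mul, Polynomial.eval_X,
        Polynomial.eval_one]
      gcongr
    · rintro _ _ _ ⟨⟩
      exact h₃
  | @query r s x y hxy hs hx hy =>
    obtain ⟨⟨⟨n, hrun⟩, ht⟩⟩ := hQ x y hxy
    replace hrun := stepsIn_iff.2 hrun
    rw [initList_eq, haltList_eq] at hrun
    have h₁ := stepsIn_transfer_in h hM x.reverse s hs []
    have h₂ := stepsIn_embedCfg h (emb := fun l => emb (.inr l)) (exit := emb (.inl true))
      (fun l => hM (.inr l)) (update s r []) hrun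
    have h₃ := stepsIn_transfer_out h hM y (update s r [])
    refine ⟨(x.length + 1) + (n + (y.length + 1)), ?_, ?_, by rintro _ _ _ ⟨⟩⟩
    · refine StepsIn.trans ?_ (StepsIn.trans h₂ ?_)
      · convert h₁ using 1
        · simp
        · simp [idle, entry]
        · simp [embedCfg]
      · convert h₃ using 1
        · rfl
        · simp
    · have := ht.trans (eval_mono time hx)
      simp only [timeBound, Polynomial.eval_add, Polynomial.eval_X, Polynomial.eval_one]
      gcongr

/-- The machine that runs the code of `c` and halts, with input register `i` and output register
`o`. -/
def machine [Fintype R] (c : Cmd R) (i o : R) : FinTM2 :=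
  letI := h.tm.kFin
  letI := h.tm.σFin
  letI := Lab.fintype h c
  { K := R ⊕ h.tm.K
    k₀ := .inl i
    k₁ := .inl o
    Γ := Alph h
    Λ := Option (Lab h c)
    main := some (entry h c)
    σ := Var h
    initialState := (none, h.tm.initialState)
    Γk₀Fin := inferInstanceAs (Fintype Bool)
    m := fun l => l.elim .halt (code h c some none) }

end Compile

/-- A function is computable in polynomial time if it is computed by a program whose oracle is a
function computable in polynomial time, with registers of polynomial length. -/
theorem polyTimeComputable_of_runs {α β γ δ : Type} {ea : α → List Bool} {eb : β → List Bool}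
    {f : α → β} (hf : PolyTimeComputable ea eb f) {eg : γ → List Bool} {ed : δ → List Bool}
    {g : γ → δ} {R : Type} [DecidableEq R] [Fintype R] (c : Cmd R) (i o : R) (p : Polynomial ℕ)
    (hc : ∀ a, Runs (fun x y => ∃ b, x = ea b ∧ y = eb (f b)) (p.eval (eg a).length) c
      (update (fun _ => []) i (eg a)) (update (fun _ => []) o (ed (g a)))) :
    PolyTimeComputable eg ed g := by
  obtain ⟨hf⟩ := hf
  let h := hf.toTM2ComputableAux
  have hi (l : List Bool) : initList (machine h c i o) l =
      idle h (some (entry h c)) (update (fun _ => []) i l) :=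
    (initList_eq (machine h c i o) l).trans <| congrArg (fun S =>
      (⟨some (some (entry h c)), (none, h.tm.initialState), S⟩ :
        TM2.Cfg (Alph h) (Option (Lab h c)) (Var h))) (update_nil_inl h i l)
  have ho (l : List Bool) : haltList (machine h c i o) l =
      (⟨none, (none, h.tm.initialState), join h (update (fun _ => []) o l) fun _ => []⟩ :
        TM2.Cfg (Alph h) (Option (Lab h c)) (Var h)) :=
    (haltList_eq (machine h c i o) l).trans <| congrArg (fun S =>
      (⟨none, (none, h.tm.initialState), S⟩ :
        TM2.Cfg (Alph h) (Option (Lab h c)) (Var h))) (update_nil_inl h o l)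
  have key (a : γ) : ∃ t, StepsIn (machine h c i o).step t
      (initList (machine h c i o) ((eg a).map (Equiv.refl Bool).invFun))
      (haltList (machine h c i o) ((ed (g a)).map (Equiv.refl Bool).invFun)) ∧
      t ≤ ((timeBound hf.time c).comp p + 1).eval (eg a).length := by
    obtain ⟨t, ht, hb, -⟩ := stepsIn_code h (time := hf.time)
      (by rintro x y ⟨b, rfl, rfl⟩; exact ⟨hf.outputsFun b⟩) (hc a)
      (M := (machine h c i o).m) some none fun l => rfl
    -- The additional step is the one that halts.
    refine ⟨t + 1, ?_, by simpa using hb⟩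
    have e (l : List Bool) : l.map (Equiv.refl Bool).invFun = l := List.map_id l
    refine (congrArg₂ (StepsIn (machine h c i o).step (t + 1))
      ((hi _).trans (congrArg _ (congrArg _ (e _)))) ((ho _).trans (congrArg (fun l =>
      (⟨none, (none, h.tm.initialState), join h (update (fun _ => []) o l) fun _ => []⟩ :
        TM2.Cfg (Alph h) (Option (Lab h c)) (Var h))) (e _)))).mpr
      (ht.trans (.head rfl (.refl _)))
  refine ⟨{ tm := machine h c i o, inputAlphabet := Equiv.refl Bool,
            outputAlphabet := Equiv.refl Bool, time := (timeBound hf.time c).comp p + 1,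
            outputsFun := fun a => ?_ }⟩
  exact ⟨⟨(key a).choose, stepsIn_iff.1 (key a).choose_spec.1⟩, (key a).choose_spec.2⟩

end StableRoommates

namespace StableRoommates

open Turing StateTransition Function

/-! ### Programming with registers -/

section Programming

variable {R : Type}

/-- Empty the register `r`, running `c₁` for every true and `c₀` for every false bit. -/
abbrev bits (r : R) (c₁ c₀ : Cmd R) : Cmd R :=
  .loop r Option.isSome (.read r c₁ c₀)

/-- Run `c₁` for every true and `c₀` for every false bit of `k`.  Meanwhile the bits are moved from
`k` to `t`, so that the length of `t` counts the iterations; afterwards `k` is restored. -/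
def each (k t : R) (c₁ c₀ : Cmd R) : Cmd R :=
  bits k (c₁ ;; .push t true) (c₀ ;; .push t false) ;; bits t (.push k true) (.push k false)

/-- Run `c` as many times as there are bits in `k`. -/
abbrev rep (k t : R) (c : Cmd R) : Cmd R := each k t c c

/-- Append as many ones to the (reversed) register `o` as there are bits in `r`. -/
abbrev print (o r t : R) : Cmd R := rep r t (.push o true)

/-- Discard the top bit of a register. -/
abbrev drop (r : R) : Cmd R := .read r .skip .skip

/-- Empty a register. -/
abbrev clear (r : R) : Cmd R := bits r .skip .skip

variable [DecidableEq R] {Q : List Bool → List Bool → Prop} {B : ℕ}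

theorem Runs.cast {c : Cmd R} {s s' s₁ s₁' : R → List Bool} (h : Runs Q B c s s') (hs : s₁ = s)
    (hs' : s' = s₁') : Runs Q B c s₁ s₁' := by
  subst hs hs'; exact h

/-- The rule for `bits`, with the state `F i` before the `i`-th iteration as loop invariant. -/
theorem runs_bits {r : R} {c₁ c₀ : Cmd R} (l : List Bool) (hl : l.length ≤ B)
    (F : ℕ → R → List Bool) (hF : ∀ i ≤ l.length, F i r = l.drop i)
    (hbody : ∀ i (hi : i < l.length),
      Runs Q B (cond l[i] c₁ c₀) (update (F i) r (l.drop (i + 1))) (F (i + 1))) :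
    Runs Q B (bits r c₁ c₀) (F 0) (F l.length) := by
  suffices h : ∀ j ≤ l.length, Runs Q B (bits r c₁ c₀) (F (l.length - j)) (F l.length) by
    simpa using h l.length le_rfl
  intro j hj
  induction j with
  | zero => exact .loop_exit (by simp [hF])
  | succ j ih =>
    have hi : l.length - (j + 1) < l.length := by omega
    have hi' : l.length - (j + 1) + 1 = l.length - j := by omega
    have hd : F (l.length - (j + 1)) r = l[l.length - (j + 1)] :: l.drop (l.length - j) := by
      rw [hF _ (by omega), List.drop_eq_getElem_cons hi, hi']
    have hb := hbody _ hi
    rw [hi'] at hb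
    refine .loop_step (by simp [hd]) (by rw [hF _ (by omega), List.length_drop]; omega)
      (.read_cons hd hb) ?_ (ih (by omega))
    rw [hd, hF _ (by omega)]
    simp

theorem runs_bits_const {r : R} {c : Cmd R} {s : R → List Bool} (hl : (s r).length ≤ B)
    (F : ℕ → R → List Bool) (hF : ∀ i ≤ (s r).length, F i r = (s r).drop i) (h₀ : F 0 = s)
    (hbody : ∀ i < (s r).length, Runs Q B c (update (F i) r ((s r).drop (i + 1))) (F (i + 1))) :
    Runs Q B (bits r c c) s (F (s r).length) := by
  have := runs_bits (c₁ := c) (c₀ := c) (Q := Q) (s r) hl F hF fun i hi => by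
    rw [Bool.cond_self]; exact hbody i hi
  rwa [h₀] at this

theorem runs_clear {r : R} {s : R → List Bool} (hl : (s r).length ≤ B) :
    Runs Q B (clear r) s (update s r []) := by
  refine (runs_bits_const hl (fun i => update s r ((s r).drop i)) (by simp) (by simp)
    fun i _ => ?_).cast rfl (by simp)
  simpa using .skip _

theorem runs_drop {r : R} {s : R → List Bool} : Runs Q B (drop r) s (update s r (s r).tail) := by
  rcases h : s r with _ | ⟨b, l⟩
  · exact (Runs.read_nil h).cast rfl (by rw [List.tail_nil, ← h, update_eq_self])
  · exact .read_cons h (by rw [Bool.cond_self]; exact .skip _)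

theorem runs_each {k t : R} (hkt : k ≠ t) {c₁ c₀ : Cmd R} (l : List Bool) (hl : l.length ≤ B)
    (F : ℕ → R → List Bool) (hbody : ∀ i (hi : i < l.length), Runs Q B (cond l[i] c₁ c₀)
      (update (update (F i) k (l.drop (i + 1))) t (l.take i).reverse)
      (update (update (F (i + 1)) k (l.drop (i + 1))) t (l.take i).reverse)) :
    Runs Q B (each k t c₁ c₀) (update (update (F 0) k l) t [])
      (update (update (F l.length) k l) t []) := by
  have hc (b : Bool) : cond b (c₁ ;; .push t true) (c₀ ;; .push t false) =
      (cond b c₁ c₀ ;; .push t b) := by cases b <;> rfl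
  have h₁ := runs_bits (Q := Q) (r := k) (c₁ := c₁ ;; .push t true) (c₀ := c₀ ;; .push t false)
    l hl (fun i => update (update (F i) k (l.drop i)) t (l.take i).reverse)
    (by simp [hkt]) fun i hi => by
      rw [hc]
      refine (hbody i hi).cast ?_ rfl |>.seq ((Runs.push _ _ _).cast rfl ?_)
      · rw [update_comm hkt, update_idem, update_comm hkt.symm]
      · rw [update_self, update_idem, ← List.take_concat_get' l i hi, List.reverse_append]; rfl
  refine (h₁.cast (by simp) rfl).seq ?_
  have h₂ := runs_bits (Q := Q) (r := t) (c₁ := .push k true) (c₀ := .push k false)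
    l.reverse (by simpa using hl)
    (fun i => update (update (F l.length) k (l.drop (l.length - i))) t (l.reverse.drop i))
    (by simp) fun i hi => by
      have hc' (b : Bool) : cond b (Cmd.push k true) (.push k false) = .push k b := by
        cases b <;> rfl
      rw [hc']
      refine (Runs.push _ _ _).cast rfl ?_
      rw [List.length_reverse] at hi
      have e : l.drop (l.length - (i + 1)) = l.reverse[i]'(by simpa) :: l.drop (l.length - i) := by
        rw [List.drop_eq_getElem_cons (by omega), List.getElem_reverse]
        congr 2 <;> omega
      rw [update_idem, update_of_ne hkt, update_self, e, update_comm hkt.symm, update_idem]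
  refine h₂.cast (by simp) ?_
  rw [List.drop_eq_nil_of_le le_rfl]
  simp

/-- `c` appends the word `w` to the output, which is stored in reverse in the register `o`, and
restores all other registers. -/
def Emits (Q : List Bool → List Bool → Prop) (B : ℕ) (o : R) (c : Cmd R) (s : R → List Bool)
    (w : List Bool) : Prop :=
  ∀ x, Runs Q B c (update s o x) (update s o (w.reverse ++ x))

theorem Emits.runs {o : R} {c : Cmd R} {s : R → List Bool} {w : List Bool}
    (h : Emits Q B o c s w) : Runs Q B c s (update s o (w.reverse ++ s o)) :=
  (h (s o)).cast (by simp) rfl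

theorem Emits.seq {o : R} {c d : Cmd R} {s : R → List Bool} {w w' : List Bool}
    (h : Emits Q B o c s w) (h' : Emits Q B o d s w') : Emits Q B o (c ;; d) s (w ++ w') :=
  fun x => (h x).seq ((h' _).cast rfl (by simp))

theorem Emits.congr {o : R} {c : Cmd R} {s : R → List Bool} {w w' : List Bool}
    (h : Emits Q B o c s w) (hw : w = w') : Emits Q B o c s w' := hw ▸ h

theorem emits_skip {o : R} {s : R → List Bool} : Emits Q B o .skip s [] :=
  fun _ => .skip _

theorem emits_push {o : R} {b : Bool} {s : R → List Bool} : Emits Q B o (.push o b) s [b] :=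
  fun _ => (Runs.push _ _ _).cast rfl (by simp)

theorem emits_each {o k t : R} {c₁ c₀ : Cmd R} {s : R → List Bool} (w : ℕ → List Bool)
    (hkt : k ≠ t) (hko : k ≠ o) (hto : t ≠ o) (ht : s t = []) (hl : (s k).length ≤ B)
    (h : ∀ i (hi : i < (s k).length), Emits Q B o (cond (s k)[i] c₁ c₀)
      (update (update s k ((s k).drop (i + 1))) t ((s k).take i).reverse) (w i)) :
    Emits Q B o (each k t c₁ c₀) s ((List.range (s k).length).flatMap w) := by
  intro x
  refine (runs_each hkt (s k) hl (fun i => update s o (((List.range i).flatMap w).reverse ++ x))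
    fun i hi => ((h i hi (((List.range i).flatMap w).reverse ++ x)).cast ?_ ?_)).cast ?_ ?_
  · rw [update_comm hko.symm, update_comm hto.symm]
  · rw [update_comm hto, update_comm hko]
    simp [List.range_succ]
  all_goals
    funext r
    by_cases h₁ : r = t
    · subst h₁; simp [hto, ht]
    · by_cases h₂ : r = k
      · subst h₂; simp [hko, h₁]
      · by_cases h₃ : r = o
        · subst h₃; simp [h₁, h₂]
        · simp [h₁, h₂, h₃]

theorem emits_rep {o k t : R} {c : Cmd R} {s : R → List Bool} (w : ℕ → List Bool)
    (hkt : k ≠ t) (hko : k ≠ o) (hto : t ≠ o) (ht : s t = []) (hl : (s k).length ≤ B)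
    (h : ∀ i < (s k).length, Emits Q B o c
      (update (update s k ((s k).drop (i + 1))) t ((s k).take i).reverse) (w i)) :
    Emits Q B o (rep k t c) s ((List.range (s k).length).flatMap w) :=
  emits_each w hkt hko hto ht hl fun i hi => by rw [Bool.cond_self]; exact h i hi

theorem emits_print {o k t : R} {s : R → List Bool} (hkt : k ≠ t) (hko : k ≠ o) (hto : t ≠ o)
    (ht : s t = []) (hl : (s k).length ≤ B) :
    Emits Q B o (print o k t) s (List.replicate (s k).length true) := by
  have := emits_rep (Q := Q) (fun _ => [true]) hkt hko hto ht hl fun i _ => emits_push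
  have e (n : ℕ) : (List.range n).flatMap (fun _ => [true]) = List.replicate n true := by
    induction n with
    | zero => rfl
    | succ n ih => rw [List.range_succ, List.flatMap_append, ih, List.replicate_succ']; rfl
  rwa [e] at this

end Programming

end StableRoommates

namespace StableRoommates

open Turing StateTransition Function

/-! ### The preference lists of the reduction -/

/-- The preference list of vertex `v`, for a graph with adjacency `A` on the vertices `0, …, n - 1`
and dummies `n, …, n + M - 1`: the neighbours, all dummies, the other vertices.  The order among the
neighbours and among the other vertices is immaterial; it is decreasing because a stack is read from
its top. -/
def vertexRow (A : ℕ → ℕ → Bool) (n M v : ℕ) : List ℕ :=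
  (List.range n).reverse.filter (A v) ++ (List.range M).map (n + ·) ++
    (List.range n).reverse.filter fun w => !A v w && w != v

/-- All dummies except the `i`-th one. -/
def otherDummies (n M i : ℕ) : List ℕ :=
  (List.range i).map (n + ·) ++ (List.range (M - 1 - i)).map (n + i + 1 + ·)

/-- Whether the `i`-th dummy prefers the vertices to the dummies: this holds for the dummies in
every third block of `n` dummies. -/
def isTop (n i : ℕ) : Bool := i / n % 3 == 0

/-- The preference list of the `i`-th dummy, who ranks the vertices in the order `V`. -/
def dummyRow (n M : ℕ) (V : List ℕ) (i : ℕ) : List ℕ :=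
  cond (isTop n i) (V ++ otherDummies n M i) (otherDummies n M i ++ V)

/-- The preference list of agent `a`; the `i`-th dummy ranks the vertices in the order
`V (i % n)`. -/
def agentRow (A : ℕ → ℕ → Bool) (n M : ℕ) (V : ℕ → List ℕ) (a : ℕ) : List ℕ :=
  if a < n then vertexRow A n M a else dummyRow n M (V ((a - n) % n)) (a - n)

/-- The vertices in the cyclic order that starts with `r`. -/
def rotation (n r : ℕ) : List ℕ :=
  r :: (List.range (n - 1 - r)).map (r + 1 + ·) ++ List.range r

/-- The code of a list of agents. -/
abbrev codeList (l : List ℕ) : List Bool := l.flatMap unary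

/-- The adjacency matrix, row by row. -/
def adjWord (A : ℕ → ℕ → Bool) (n : ℕ) : List Bool :=
  (List.range n).flatMap fun v => (List.range n).map (A v)

theorem flatMap_unary (m : ℕ) (f : ℕ → ℕ) :
    (List.range m).flatMap (fun i => unary (f i)) = codeList ((List.range m).map f) :=
  (List.flatMap_map ..).symm

/-! ### Programs that write preference lists -/

/-- The registers.  With `n` vertices, `n₁`, `n₂`, `n₃` have length `n` (as nested loops need
separate counters), `copies` and `thr` hold the parameters of the reduction in unary, `todo` and
`done` count the dummies behind and before the current one, `row₁` and `row₀` hold a row of the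
adjacency matrix and its negation, `acc` holds the distance in unary, and `z₁`, …, `z₅` serve to
restore the loop registers. -/
inductive Reg
  | inp | out | n₁ | n₂ | n₃ | copies | todo | done | thr | row₁ | row₀ | acc
  | z₁ | z₂ | z₃ | z₄ | z₅
  deriving DecidableEq

instance : Fintype Reg :=
  Fintype.ofList [.inp, .out, .n₁, .n₂, .n₃, .copies, .todo, .done, .thr, .row₁, .row₀, .acc,
    .z₁, .z₂, .z₃, .z₄, .z₅] (by intro r; cases r <;> simp)

/-- Emit the agent whose number is the length of `k`. -/
def name (k : Reg) : Cmd Reg := print .out k .z₂ ;; .push .out false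

/-- Emit the dummy whose number is the length of `k`. -/
def dummyName (k : Reg) : Cmd Reg := print .out .n₂ .z₂ ;; name k

/-- Emit the positions of the ones in the register `k`, which is read from its end. -/
def ones (k : Reg) : Cmd Reg := each k .z₁ (name k) .skip

/-- Emit all dummies but the current one, who has as many dummies before it as there are bits in
`done`, and as many behind it as there are bits in `todo`. -/
def otherDummiesCmd : Cmd Reg :=
  rep .done .z₁ (dummyName .z₁) ;;
    rep .todo .z₁ (print .out .n₂ .z₂ ;; print .out .done .z₂ ;; .push .out true ;; name .z₁)

/-- Move an entry of the adjacency matrix from the input to `row₁` and its negation to `row₀`. -/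
def readEntry : Cmd Reg :=
  .read .inp (.push .row₁ true ;; .push .row₀ false) (.push .row₁ false ;; .push .row₀ true)

/-- Read a row of the adjacency matrix and emit the preference list of the vertex.  The vertex has
as many vertices before it as there are bits in `z₅`, and as many behind it as in `n₁`. -/
def vertexRowCmd : Cmd Reg :=
  -- The vertex itself counts neither as a neighbour nor as a non-neighbour.
  rep .z₅ .z₁ readEntry ;; (drop .inp ;; .push .row₁ false ;; .push .row₀ false) ;;
    rep .n₁ .z₁ readEntry ;;
    (ones .row₁ ;; rep .todo .z₁ (dummyName .z₁) ;; ones .row₀) ;; clear .row₁ ;; clear .row₀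

/-- Emit the vertices in increasing order. -/
def increasingCmd : Cmd Reg := rep .n₂ .z₁ (name .z₁)

/-- Emit the vertices in the cyclic order that starts with the number in `z₄`. -/
def rotationCmd : Cmd Reg :=
  name .z₄ ;; rep .n₁ .z₁ (print .out .z₄ .z₂ ;; .push .out true ;; name .z₁) ;;
    rep .z₄ .z₁ (name .z₁)

/-- Emit the preference lists of the next `n` dummies, where `V` emits the vertices. -/
def blockCmd (V : Cmd Reg) (top : Bool) : Cmd Reg :=
  rep .n₁ .z₄ (drop .todo ;; cond top (V ;; otherDummiesCmd) (otherDummiesCmd ;; V) ;;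
    .push .done true)

/-- Emit an instance. -/
def instanceCmd (V : Cmd Reg) : Cmd Reg :=
  rep .n₁ .z₅ vertexRowCmd ;;
    rep .copies .z₅ (blockCmd V true ;; blockCmd V false ;; blockCmd V false) ;;
    bits .done (.push .todo true) (.push .todo true)

section Spec

variable {Q : List Bool → List Bool → Prop} {B : ℕ} {s : Reg → List Bool}

theorem unary_add (a b : ℕ) : List.replicate a true ++ unary b = unary (a + b) := by
  rw [unary, unary, ← List.append_assoc, List.replicate_append_replicate]

theorem emits_name {k : Reg} (hk : k ≠ .z₂) (hk' : k ≠ .out) (hz : s .z₂ = [])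
    (hl : (s k).length ≤ B) : Emits Q B .out (name k) s (unary (s k).length) :=
  (emits_print hk hk' (by simp) hz hl).seq emits_push

theorem emits_dummyName {k : Reg} (hk : k ≠ .z₂) (hk' : k ≠ .out) (hz : s .z₂ = [])
    (hl : (s k).length ≤ B) (hn : (s .n₂).length ≤ B) :
    Emits Q B .out (dummyName k) s (unary ((s .n₂).length + (s k).length)) := by
  rw [← unary_add]
  exact (emits_print (by simp) (by simp) (by simp) hz hn).seq (emits_name hk hk' hz hl)

theorem flatMap_range_reverse (n : ℕ) (f : ℕ → Bool) :
    (List.range n).flatMap (fun i => cond (f (n - 1 - i)) (unary (n - 1 - i)) []) =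
      codeList ((List.range n).reverse.filter f) := by
  have h (l : List ℕ) : l.flatMap (fun i => cond (f i) (unary i) []) = codeList (l.filter f) := by
    induction l with
    | nil => rfl
    | cons a l ih => cases ha : f a <;> simp [List.flatMap_cons, ih, ha, codeList]
  rw [← h, List.range_eq_range', List.reverse_range', List.flatMap_map, ← List.range_eq_range']
  simp

theorem emits_ones {k : Reg} (hk₁ : k ≠ .z₁) (hk : k ≠ .z₂) (hk' : k ≠ .out) (h₁ : s .z₁ = [])
    (h₂ : s .z₂ = []) {n : ℕ} {f : ℕ → Bool} (hs : s k = ((List.range n).map f).reverse)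
    (hn : n ≤ B) : Emits Q B .out (ones k) s (codeList ((List.range n).reverse.filter f)) := by
  have hl : (s k).length = n := by simp [hs]
  have := emits_each (Q := Q) (B := B) (o := .out) (c₁ := name k) (c₀ := .skip) (s := s)
    (fun i => cond (f (n - 1 - i)) (unary (n - 1 - i)) []) hk₁ hk' (by simp) h₁ (hl.trans_le hn)
    fun i hi => by
      have e : (s k)[i] = f (n - 1 - i) := by simp [hs]
      rw [e]
      cases f (n - 1 - i)
      · exact emits_skip
      · refine (emits_name hk hk' (by simp [h₂, hk.symm]) ?_).congr ?_ <;>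
          simp [hk₁, hl]
        · omega
        · congr 1; omega
  rwa [hl, flatMap_range_reverse] at this

theorem emits_otherDummiesCmd {n M i : ℕ} (h₁ : s .z₁ = []) (h₂ : s .z₂ = [])
    (hn : (s .n₂).length = n) (hd : (s .done).length = i) (ht : (s .todo).length = M - 1 - i)
    (hnB : n ≤ B) (hiB : i ≤ B) (hMB : M ≤ B) :
    Emits Q B .out otherDummiesCmd s (codeList (otherDummies n M i)) := by
  rw [otherDummies, codeList, List.flatMap_append, ← codeList, ← codeList, ← flatMap_unary,
    ← flatMap_unary, ← ht, ← hd]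
  refine (emits_rep _ (by simp) (by simp) (by simp) h₁ (by omega) fun j hj => ?_).seq
    (emits_rep _ (by simp) (by simp) (by simp) h₁ (by omega) fun j hj => ?_)
  · refine (emits_dummyName (by simp) (by simp) (by simp [h₂]) ?_ ?_).congr ?_
    · simp; omega
    · simp; omega
    · simp [hn, hj.le]
  · refine ((emits_print (by simp) (by simp) (by simp) (by simp [h₂]) ?_).seq
      ((emits_print (by simp) (by simp) (by simp) (by simp [h₂]) ?_).seq
      (emits_push.seq (emits_name (by simp) (by simp) (by simp [h₂]) ?_)))).congr ?_
    · simp; omega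
    · simp; omega
    · simp; omega
    · rw [show [true] = List.replicate 1 true from rfl, unary_add, unary_add, unary_add]
      congr 1
      simp [hn, hj.le]
      omega

theorem emits_allDummies {n M : ℕ} (h₁ : s .z₁ = []) (h₂ : s .z₂ = [])
    (hn : (s .n₂).length = n) (ht : (s .todo).length = M) (hnB : n ≤ B) (hMB : M ≤ B) :
    Emits Q B .out (rep .todo .z₁ (dummyName .z₁)) s (codeList ((List.range M).map (n + ·))) := by
  rw [← flatMap_unary, ← ht]
  refine emits_rep _ (by simp) (by simp) (by simp) h₁ (by omega) fun j hj => ?_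
  refine (emits_dummyName (by simp) (by simp) (by simp [h₂]) ?_ ?_).congr ?_
  · simp; omega
  · simp; omega
  · simp [hn, hj.le]

/-- `c` emits the vertices in the order `V r`, where `r` is the number of iterations of a loop over
`n₁` that counts them in `z₄`. -/
def EmitsVertices (Q : List Bool → List Bool → Prop) (B n : ℕ) (c : Cmd Reg) (V : ℕ → List ℕ) :
    Prop :=
  ∀ s : Reg → List Bool, s .z₁ = [] → s .z₂ = [] → (s .n₂).length = n →
    (s .z₄).length + (s .n₁).length + 1 = n → Emits Q B .out c s (codeList (V (s .z₄).length))

theorem emitsVertices_increasing {n : ℕ} (hnB : n ≤ B) :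
    EmitsVertices Q B n increasingCmd fun _ => List.range n := by
  intro s h₁ h₂ hn _
  have := flatMap_unary n id
  rw [List.map_id] at this
  rw [← this, ← hn]
  refine emits_rep _ (by simp) (by simp) (by simp) h₁ (by omega) fun j hj => ?_
  refine (emits_name (by simp) (by simp) (by simp [h₂]) ?_).congr ?_
  · simp; omega
  · simp [hj.le]

theorem emitsVertices_rotation {n : ℕ} (hnB : n ≤ B) :
    EmitsVertices Q B n rotationCmd (rotation n) := by
  intro s h₁ h₂ hn hr
  have h := flatMap_unary (s .z₄).length id
  rw [List.map_id] at h
  rw [rotation, codeList, List.flatMap_append, List.flatMap_cons, ← codeList, ← codeList, ← h,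
    ← flatMap_unary, show n - 1 - (s .z₄).length = (s .n₁).length by omega, List.append_assoc]
  refine (emits_name (by simp) (by simp) h₂ (by omega)).seq
    ((emits_rep _ (by simp) (by simp) (by simp) h₁ (by omega) fun j hj => ?_).seq
    (emits_rep _ (by simp) (by simp) (by simp) h₁ (by omega) fun j hj => ?_))
  · refine ((emits_print (by simp) (by simp) (by simp) (by simp [h₂]) ?_).seq
      (emits_push.seq (emits_name (by simp) (by simp) (by simp [h₂]) ?_))).congr ?_
    · simp; omega
    · simp; omega
    · rw [show [true] = List.replicate 1 true from rfl, unary_add, unary_add]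
      congr 1
      simp [hj.le]
      omega
  · refine (emits_name (by simp) (by simp) (by simp [h₂]) ?_).congr ?_
    · simp; omega
    · simp [hj.le]

theorem runs_readEntry {b : Bool} {l : List Bool} (h : s .inp = b :: l) :
    Runs Q B readEntry s
      (update (update (update s .inp l) .row₁ (b :: s .row₁)) .row₀ ((!b) :: s .row₀)) := by
  refine .read_cons h ?_
  cases b <;> exact ((Runs.push ..).seq (.push ..)).cast rfl (by simp)

theorem runs_readEntries {k : Reg} (hk : k = .z₅ ∨ k = .n₁) (h₁ : s .z₁ = []) {l l' : List Bool}
    (h : s .inp = l ++ l') (hl : l.length = (s k).length) (hB : l.length ≤ B) :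
    Runs Q B (rep k .z₁ readEntry) s
      (update (update (update s .inp l') .row₁ (l.reverse ++ s .row₁)) .row₀
        ((l.map not).reverse ++ s .row₀)) := by
  have hk₁ : k ≠ .z₁ := by rcases hk with rfl | rfl <;> simp
  refine (runs_each hk₁ (s k) (by omega) (fun i =>
    update (update (update s .inp (l.drop i ++ l')) .row₁ ((l.take i).reverse ++ s .row₁)) .row₀
        (((l.take i).map not).reverse ++ s .row₀)) fun i hi => ?_).cast ?_ ?_
  · rw [Bool.cond_self]
    have hi' : i < l.length := by omega
    have e : l.drop i ++ l' = l[i] :: (l.drop (i + 1) ++ l') := by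
      rw [List.drop_eq_getElem_cons hi']; rfl
    refine (runs_readEntry (b := l[i]) (l := l.drop (i + 1) ++ l') ?_).cast rfl ?_
    · rw [← e]
      rcases hk with rfl | rfl <;> simp
    · have t (l : List Bool) (h : i < l.length) :
          (l.take (i + 1)).reverse = l[i] :: (l.take i).reverse := by
        rw [← List.take_concat_get' l i h]; simp
      have t₁ := t l hi'
      have t₀ := t (l.map not) (by simpa using hi')
      funext r
      rcases hk with rfl | rfl <;> cases r <;> simp [t₁, t₀]
  · funext r
    rcases hk with rfl | rfl <;> cases r <;> simp [h, h₁]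
  · funext r
    rcases hk with rfl | rfl <;> cases r <;> simp [← hl, h₁]

theorem range_map_split {α : Type} (f : ℕ → α) (v k : ℕ) :
    (List.range (v + 1 + k)).map f =
      (List.range v).map f ++ f v :: (List.range k).map fun j => f (v + 1 + j) := by
  rw [List.range_add, List.range_succ]
  simp [Function.comp_def]

theorem runs_vertexRowCmd {A : ℕ → ℕ → Bool} {n M v : ℕ} (hv : v < n) (hA : A v v = false)
    (h₁ : s .z₁ = []) (h₂ : s .z₂ = []) (hr₁ : s .row₁ = []) (hr₀ : s .row₀ = [])
    (hn : (s .n₂).length = n) (ht : (s .todo).length = M) (hz : (s .z₅).length = v)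
    (hn₁ : (s .n₁).length = n - 1 - v) (hnB : n ≤ B) (hMB : M ≤ B) {l : List Bool}
    (h : s .inp = (List.range n).map (A v) ++ l) :
    Runs Q B vertexRowCmd s (update (update s .inp l) .out
      ((codeList (vertexRow A n M v)).reverse ++ s .out)) := by
  obtain ⟨k, rfl⟩ : ∃ k, n = v + 1 + k := ⟨n - (v + 1), by omega⟩
  rw [range_map_split, List.append_assoc, List.cons_append] at h
  set l₁ := (List.range v).map (A v) with hl₁
  set l₂ := (List.range k).map fun j => A v (v + 1 + j) with hl₂
  let f₀ : ℕ → Bool := fun w => !A v w && w != v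
  have e₁ : ((List.range (v + 1 + k)).map (A v)).reverse =
      l₂.reverse ++ false :: l₁.reverse := by
    rw [range_map_split, hA]; simp [l₁, l₂]
  have e₀ : ((List.range (v + 1 + k)).map f₀).reverse =
      (l₂.map not).reverse ++ false :: (l₁.map not).reverse := by
    rw [range_map_split]
    simp only [f₀, l₁, l₂, hA, List.map_map]
    have a₁ : (List.range v).map (fun w => !A v w && w != v) = (List.range v).map (not ∘ A v) := by
      refine List.map_congr_left fun w hw => ?_
      have : w ≠ v := by simp at hw; omega
      simp [this]
    have a₂ : (List.range k).map (fun j => !A v (v + 1 + j) && v + 1 + j != v) =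
        (List.range k).map (not ∘ fun j => A v (v + 1 + j)) := by
      refine List.map_congr_left fun w hw => ?_
      have : v + 1 + w ≠ v := by omega
      simp [this]
    rw [a₁, a₂]
    simp
  let s₁ : Reg → List Bool := update (update (update s .inp l) .row₁
    ((List.range (v + 1 + k)).map (A v)).reverse) .row₀ ((List.range (v + 1 + k)).map f₀).reverse
  refine Runs.seq (runs_readEntries (.inl rfl) h₁ h (by simp [l₁, hz]) (by simp [l₁]; omega)) ?_
  refine Runs.seq (runs_drop.seq (.seq (.push ..) (.push ..))) ?_
  refine Runs.seq ((runs_readEntries (l := l₂) (l' := l) (.inr rfl) (by simp [h₁]) (by simp)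
    (by simp [l₂, hn₁]) (by simp [l₂]; omega)).cast (s₁' := s₁) rfl ?_) ?_
  · simp only [s₁, e₁, e₀]
    funext r
    cases r <;> simp [hr₁, hr₀]
  have hrow : Emits Q B .out (ones .row₁ ;; rep .todo .z₁ (dummyName .z₁) ;; ones .row₀) s₁
      (codeList (vertexRow A (v + 1 + k) M v)) := by
    rw [vertexRow, List.append_assoc, codeList, List.flatMap_append, List.flatMap_append]
    refine (emits_ones (by simp) (by simp) (by simp) ?_ ?_ ?_ hnB).seq
      ((emits_allDummies ?_ ?_ ?_ ?_ hnB hMB).seq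
      (emits_ones (by simp) (by simp) (by simp) ?_ ?_ ?_ hnB)) <;> simp [s₁, h₁, h₂, hn, ht, f₀]
  refine hrow.runs.seq ((runs_clear ?_).seq ((runs_clear ?_).cast rfl ?_))
  · simp [s₁]; omega
  · simp [s₁]; omega
  · funext r
    cases r <;> simp [s₁, hr₁, hr₀]

/-- The state during the emission of the dummies' lists, before the `i`-th one. -/
def dummyState (s : Reg → List Bool) (x : List Bool) (n M : ℕ) (V : ℕ → List ℕ) (i : ℕ) :
    Reg → List Bool :=
  update (update (update s .todo (List.replicate (M - i) true)) .done (List.replicate i true)) .out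
    (((List.range i).flatMap fun i => codeList (dummyRow n M (V (i % n)) i)).reverse ++ x)

theorem runs_blockCmd {n M q : ℕ} {V : ℕ → List ℕ} {c : Cmd Reg} {x : List Bool} {top : Bool}
    (hc : EmitsVertices Q B n c V) (h₁ : s .z₁ = []) (h₂ : s .z₂ = []) (h₄ : s .z₄ = [])
    (hn : (s .n₂).length = n) (hn₁ : (s .n₁).length = n) (hnB : n ≤ B) (hMB : M ≤ B)
    (hq : q * n + n ≤ M) (htop : (q % 3 == 0) = top) :
    Runs Q B (blockCmd c top) (dummyState s x n M V (q * n))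
      (dummyState s x n M V ((q + 1) * n)) := by
  refine (runs_each (by simp) (s .n₁) (by omega) (fun i => dummyState s x n M V (q * n + i))
    fun i hi => ?_).cast ?_ ?_
  · rw [hn₁] at hi
    rw [Bool.cond_self]
    have hdiv : (q * n + i) / n = q := by
      rw [Nat.mul_comm, Nat.mul_add_div (by omega), Nat.div_eq_of_lt hi, Nat.add_zero]
    have hmod : (q * n + i) % n = i := by
      rw [Nat.mul_comm, Nat.mul_add_mod, Nat.mod_eq_of_lt hi]
    refine runs_drop.seq ?_
    set s₁ := update _ Reg.todo _ with hs₁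
    have ht₁ : s₁ .todo = List.replicate (M - 1 - (q * n + i)) true := by
      simp [s₁, dummyState]; omega
    have hd₁ : s₁ .done = List.replicate (q * n + i) true := by simp [s₁, dummyState]
    have hz₁ : s₁ .z₁ = [] := by simp [s₁, dummyState, h₁]
    have hz₂ : s₁ .z₂ = [] := by simp [s₁, dummyState, h₂]
    have hz₄ : (s₁ .z₄).length = i := by simp [s₁, dummyState]; omega
    have hn₁' : (s₁ .n₁).length = n - 1 - i := by simp [s₁, dummyState]; omega
    have hn₂ : (s₁ .n₂).length = n := by simp [s₁, dummyState, hn]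
    have hV := hc s₁ hz₁ hz₂ hn₂ (by omega)
    have hD := emits_otherDummiesCmd (Q := Q) (B := B) (M := M) (i := q * n + i) hz₁ hz₂ hn₂
      (by simp [hd₁]) (by simp [ht₁]) hnB (by omega) hMB
    have hrow : Emits Q B .out (cond top (c ;; otherDummiesCmd) (otherDummiesCmd ;; c)) s₁
        (codeList (dummyRow n M (V ((q * n + i) % n)) (q * n + i))) := by
      rw [dummyRow, isTop, hdiv, hmod, htop]
      rw [hz₄] at hV
      cases top
      · exact (hD.seq hV).congr List.flatMap_append.symm
      · exact (hV.seq hD).congr List.flatMap_append.symm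
    refine hrow.runs.seq ((Runs.push ..).cast rfl ?_)
    funext r
    cases r <;> simp [s₁, dummyState, List.range_succ, ← Nat.add_assoc, List.replicate_succ]
    omega
  · funext r
    cases r <;> simp [dummyState, h₄]
  · rw [hn₁, Nat.succ_mul]
    funext r
    cases r <;> simp [dummyState, h₄]

end Spec
end StableRoommates

namespace StableRoommates

open Turing StateTransition Function

/-! ### The program for an instance -/

/-- The code of the instance with the preference lists `agentRow A n M V`. -/
def instanceWord (A : ℕ → ℕ → Bool) (n M : ℕ) (V : ℕ → List ℕ) : List Bool :=
  (List.range (n + M)).flatMap fun a => codeList (agentRow A n M V a)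

section

variable {Q : List Bool → List Bool → Prop} {B : ℕ} {s : Reg → List Bool}

theorem instanceWord_eq (A : ℕ → ℕ → Bool) (n M : ℕ) (V : ℕ → List ℕ) : instanceWord A n M V =
    ((List.range n).flatMap fun v => codeList (vertexRow A n M v)) ++
      (List.range M).flatMap fun i => codeList (dummyRow n M (V (i % n)) i) := by
  rw [instanceWord, List.range_add, List.flatMap_append, List.flatMap_map]
  congr 1
  · refine List.flatMap_congr fun v hv => ?_
    rw [agentRow, if_pos (List.mem_range.1 hv)]
  · refine List.flatMap_congr fun i _ => ?_
    rw [agentRow, if_neg (by omega), Nat.add_sub_cancel_left]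

theorem runs_instanceCmd {A : ℕ → ℕ → Bool} {n k : ℕ} {V : ℕ → List ℕ} {c : Cmd Reg}
    (hA : ∀ v, A v v = false) (hc : EmitsVertices Q B n c V)
    (h₁ : s .z₁ = []) (h₂ : s .z₂ = []) (h₄ : s .z₄ = []) (h₅ : s .z₅ = [])
    (hr₁ : s .row₁ = []) (hr₀ : s .row₀ = []) (hn₁ : (s .n₁).length = n)
    (hn₂ : (s .n₂).length = n) (hk : (s .copies).length = k)
    (ht : s .todo = List.replicate (3 * k * n) true) (hd : s .done = []) (hnB : n ≤ B)
    (hkB : k ≤ B) (hMB : 3 * k * n ≤ B) {l : List Bool} (h : s .inp = adjWord A n ++ l) :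
    Runs Q B (instanceCmd c) s (update (update s .inp l) .out
      ((instanceWord A n (3 * k * n) V).reverse ++ s .out)) := by
  set M := 3 * k * n with hM
  let w (i : ℕ) : List Bool := (List.range i).flatMap fun v => codeList (vertexRow A n M v)
  let F (i : ℕ) : Reg → List Bool := update (update s .inp
    (((List.range (n - i)).flatMap fun v => (List.range n).map (A (i + v))) ++ l)) .out
      ((w i).reverse ++ s .out)
  have hvert : Runs Q B (rep .n₁ .z₅ vertexRowCmd) s
      (update (update s .inp l) .out ((w n).reverse ++ s .out)) := by
    refine (runs_each (by simp) (s .n₁) (by omega) F fun i hi => ?_).cast ?_ ?_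
    · rw [hn₁] at hi
      rw [Bool.cond_self]
      have hrest : F i .inp = (List.range n).map (A i) ++ F (i + 1) .inp := by
        simp only [F, ne_eq, reduceCtorEq, not_false_eq_true, update_of_ne, update_self]
        rw [show n - i = (n - (i + 1)) + 1 by omega, List.range_succ_eq_map, List.flatMap_cons,
          List.flatMap_map, List.append_assoc, Nat.add_zero]
        simp only [Nat.succ_eq_add_one, Nat.add_right_comm i 1, ← Nat.add_assoc]
      refine (runs_vertexRowCmd (A := A) (n := n) (M := M) hi (hA i) ?_ ?_ ?_ ?_ ?_ ?_ ?_ ?_ hnB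
        hMB (l := F (i + 1) .inp) ?_).cast rfl ?_
      · simp [F, h₁]
      · simp [F, h₂]
      · simp [F, hr₁]
      · simp [F, hr₀]
      · simp [F, hn₂]
      · simp [F, ht, M]
      · simp [hn₁]; omega
      · simp [hn₁]; omega
      · simpa using hrest
      · funext r
        cases r <;> simp [F, w, List.range_succ]
    · funext r
      cases r <;> simp [F, w, h₅, h, adjWord]
    · funext r
      cases r <;> simp [F, h₅, hn₁]
  refine hvert.seq ?_
  set s₁ := update (update s .inp l) .out ((w n).reverse ++ s .out) with hs₁
  have hdum : Runs Q B (rep .copies .z₅ (blockCmd c true ;; blockCmd c false ;; blockCmd c false))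
      s₁ (dummyState s₁ (s₁ .out) n M V M) := by
    refine (runs_each (by simp) (s₁ .copies) (by simp [s₁]; omega)
      (fun i => dummyState s₁ (s₁ .out) n M V (3 * i * n)) fun i hi => ?_).cast ?_ ?_
    · rw [Bool.cond_self]
      rw [show s₁ .copies = s .copies by simp [s₁]] at hi ⊢
      rw [hk] at hi
      let s₂ := update (update s₁ .copies ((s .copies).drop (i + 1))) .z₅
        ((s .copies).take i).reverse
      have hcomm (j : ℕ) : update (update (dummyState s₁ (s₁ .out) n M V j) .copies
          ((s .copies).drop (i + 1))) .z₅ ((s .copies).take i).reverse =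
          dummyState s₂ (s₁ .out) n M V j := by
        funext r
        cases r <;> simp [dummyState, s₂]
      rw [hcomm, hcomm]
      have hle : (3 * i + 3) * n ≤ M := by
        rw [hM]; exact Nat.mul_le_mul_right _ (by omega)
      have hblock {q : ℕ} {top : Bool} (hq : q + 1 ≤ 3 * i + 3) (htop : (q % 3 == 0) = top) :
          Runs Q B (blockCmd c top) (dummyState s₂ (s₁ .out) n M V (q * n))
            (dummyState s₂ (s₁ .out) n M V ((q + 1) * n)) := by
        refine runs_blockCmd hc ?_ ?_ ?_ ?_ ?_ hnB hMB ?_ htop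
        · simp [s₂, s₁, h₁]
        · simp [s₂, s₁, h₂]
        · simp [s₂, s₁, h₄]
        · simp [s₂, s₁, hn₂]
        · simp [s₂, s₁, hn₁]
        · rw [← Nat.succ_mul]
          exact (Nat.mul_le_mul_right _ hq).trans hle
      refine (hblock (by omega) ?_).seq ((hblock (by omega) ?_).seq (hblock (by omega) ?_))
      all_goals simp; try omega
    · funext r
      cases r <;> simp [dummyState, s₁, h₅, hd, ht]
    · funext r
      cases r <;> simp [dummyState, s₁, hk, h₅, ← hM]
  refine hdum.seq ?_
  refine (runs_bits_const (by simp [dummyState]; omega) (fun i => update (update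
    (dummyState s₁ (s₁ .out) n M V M) .done (List.replicate (M - i) true)) .todo
      (List.replicate i true)) ?_ ?_ fun i hi => ?_).cast rfl ?_
  · intro i _
    simp [dummyState]
  · funext r
    cases r <;> simp [dummyState]
  · refine (Runs.push ..).cast rfl ?_
    funext r
    cases r <;> simp [dummyState, List.replicate_succ]
  · rw [instanceWord_eq]
    funext r
    cases r <;> simp [dummyState, s₁, hd, ht, w]

end

end StableRoommates

namespace StableRoommates

open Turing StateTransition Function

/-! ### The program for Graph Isomorphism -/

/-- Read the number of vertices. -/
def parseCmd : Cmd Reg :=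
  .loop .inp (· == some true) (drop .inp ;; .push .n₁ true ;; .push .n₂ true ;; .push .n₃ true) ;;
    drop .inp

/-- Compute the sizes of the construction and the threshold. -/
def sizesCmd : Cmd Reg :=
  (rep .n₁ .z₁ (rep .n₂ .z₂ (.push .copies true ;; .push .copies true)) ;; .push .copies true) ;;
    rep .n₁ .z₁ (rep .copies .z₂ (.push .todo true ;; .push .todo true ;; .push .todo true)) ;;
    rep .n₁ .z₁ (rep .n₂ .z₂ (rep .n₃ .z₃ (print .thr .copies .z₄))) ;; .push .thr true

/-- Double the content of `acc`. -/
def doubleCmd : Cmd Reg :=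
  bits .acc (.push .z₁ true ;; .push .z₁ true) (.push .z₁ true ;; .push .z₁ true) ;;
    bits .z₁ (.push .acc true) (.push .acc true)

/-- Convert the binary number in `out` to a unary number in `acc` by Horner's rule. -/
def decodeCmd : Cmd Reg := bits .out (doubleCmd ;; .push .acc true) doubleCmd

/-- Output whether the number in `acc` is less than the number in `thr`: this holds if `thr` is not
empty after as many bits as `acc` has are dropped. -/
def compareCmd : Cmd Reg :=
  bits .acc (drop .thr) (drop .thr) ;; .push .out false ;;
    bits .thr (drop .out ;; .push .out true) (drop .out ;; .push .out true)

/-- Decide whether two graphs are isomorphic, with an oracle for the distance of instances. -/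
def isoCmd : Cmd Reg :=
  parseCmd ;; sizesCmd ;; (print .out .n₁ .z₁ ;; name .todo) ;; instanceCmd increasingCmd ;;
    instanceCmd rotationCmd ;; .query .out ;; decodeCmd ;; compareCmd ;;
    clear .n₁ ;; clear .n₂ ;; clear .n₃ ;; clear .copies ;; clear .todo

section

variable {Q : List Bool → List Bool → Prop} {B : ℕ} {s : Reg → List Bool}

theorem runs_parseCmd {n : ℕ} {l : List Bool} (h : s .inp = unary n ++ l)
    (hB : (s .inp).length ≤ B) : Runs Q B parseCmd s
      (update (update (update (update s .inp l) .n₁ (List.replicate n true ++ s .n₁))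
        .n₂ (List.replicate n true ++ s .n₂)) .n₃ (List.replicate n true ++ s .n₃)) := by
  suffices hloop : Runs Q B (.loop .inp (· == some true)
      (drop .inp ;; .push .n₁ true ;; .push .n₂ true ;; .push .n₃ true)) s
      (update (update (update (update s .inp (false :: l)) .n₁ (List.replicate n true ++ s .n₁))
        .n₂ (List.replicate n true ++ s .n₂)) .n₃ (List.replicate n true ++ s .n₃)) by
    refine hloop.seq (runs_drop.cast rfl ?_)
    funext r
    cases r <;> simp
  induction n generalizing s with
  | zero =>
    refine (Runs.loop_exit (by simp [h, unary])).cast rfl ?_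
    funext r
    cases r <;> simp [h, unary]
  | succ n ih =>
    have h' : s .inp = true :: (unary n ++ l) := by simp [h, unary, List.replicate_succ]
    refine .loop_step (by simp [h']) hB (runs_drop.seq ((Runs.push ..).seq
      ((Runs.push ..).seq (.push ..)))) ?_ ((ih ?_ ?_).cast rfl ?_)
    · simp [h']
    · simp [h']
    · simp [h'] at hB ⊢; omega
    · funext r
      cases r <;> simp [List.replicate_succ']

theorem emits_rep_replicate {o k t : Reg} {c : Cmd Reg} (b : ℕ)
    (hkt : k ≠ t) (hko : k ≠ o) (hto : t ≠ o) (ht : s t = []) (hl : (s k).length ≤ B)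
    (h : ∀ i < (s k).length, Emits Q B o c
      (update (update s k ((s k).drop (i + 1))) t ((s k).take i).reverse)
      (List.replicate b true)) :
    Emits Q B o (rep k t c) s (List.replicate ((s k).length * b) true) := by
  refine (emits_rep _ hkt hko hto ht hl h).congr ?_
  generalize (s k).length = m
  induction m with
  | zero => simp
  | succ m ih =>
    rw [List.range_succ, List.flatMap_append, ih, Nat.succ_mul, List.replicate_add]
    simp

/-- The number of dummies for every vertex is three times this number.  It is odd, so that the
number `n * (3 * numCopies n + 1)` of agents is even, and exceeds `n ^ 2`, so that the vertices'
lists cannot outweigh the dummies. -/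
def numCopies (n : ℕ) : ℕ := 2 * n ^ 2 + 1

/-- The threshold: the graphs are isomorphic if and only if the distance is smaller. -/
def threshold (n : ℕ) : ℕ := numCopies n * n ^ 3 + 1

theorem runs_sizesCmd {n : ℕ} (h₁ : s .z₁ = []) (h₂ : s .z₂ = []) (h₃ : s .z₃ = [])
    (h₄ : s .z₄ = []) (hn₁ : (s .n₁).length = n) (hn₂ : (s .n₂).length = n)
    (hn₃ : (s .n₃).length = n) (hc : s .copies = []) (ht : s .todo = []) (hr : s .thr = [])
    (hnB : n ≤ B) (hkB : numCopies n ≤ B) : Runs Q B sizesCmd s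
      (update (update (update s .copies (List.replicate (numCopies n) true))
        .todo (List.replicate (3 * numCopies n * n) true))
        .thr (List.replicate (threshold n) true)) := by
  have hcop : Emits Q B .copies
      (rep .n₁ .z₁ (rep .n₂ .z₂ (.push .copies true ;; .push .copies true)) ;; .push .copies true) s
      (List.replicate (numCopies n) true) := by
    refine ((emits_rep_replicate (n * 2) (by simp) (by simp) (by simp) h₁ (by omega)
      fun i _ => (emits_rep_replicate 2 (by simp) (by simp) (by simp) (by simp [h₂])
        (by simp; omega) fun j _ => emits_push.seq emits_push).congr ?_).seq emits_push).congr ?_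
    · simp [hn₂]
    · rw [hn₁, show [true] = List.replicate 1 true from rfl, List.replicate_append_replicate,
        numCopies]
      congr 1
      ring
  refine (hcop.runs.cast rfl (s₁' := update s .copies (List.replicate (numCopies n) true))
    (by simp [hc])).seq ?_
  set s₁ := update s .copies (List.replicate (numCopies n) true) with hs₁
  have htodo : Emits Q B .todo
      (rep .n₁ .z₁ (rep .copies .z₂ (.push .todo true ;; .push .todo true ;; .push .todo true))) s₁
      (List.replicate (3 * numCopies n * n) true) := by
    refine (emits_rep_replicate (numCopies n * 3) (by simp) (by simp) (by simp) (by simp [s₁, h₁])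
      (by simp [s₁]; omega)
      fun i _ => (emits_rep_replicate 3 (by simp) (by simp) (by simp) (by simp [s₁, h₂])
        (by simp [s₁]; omega) fun j _ => emits_push.seq (emits_push.seq emits_push)).congr
          ?_).congr ?_
    · simp [s₁]
    · congr 1
      simp [s₁, hn₁]
      ring
  refine (htodo.runs.cast rfl (s₁' := update s₁ .todo (List.replicate (3 * numCopies n * n) true))
    (by simp [s₁, ht])).seq ?_
  set s₂ := update s₁ .todo (List.replicate (3 * numCopies n * n) true) with hs₂
  have hthr : Emits Q B .thr
      (rep .n₁ .z₁ (rep .n₂ .z₂ (rep .n₃ .z₃ (print .thr .copies .z₄))) ;; .push .thr true) s₂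
      (List.replicate (threshold n) true) := by
    refine ((emits_rep_replicate (n * (n * numCopies n)) (by simp) (by simp) (by simp) ?_ ?_
      fun i _ => (emits_rep_replicate (n * numCopies n) (by simp) (by simp) (by simp) ?_ ?_
      fun i _ => (emits_rep_replicate (numCopies n) (by simp) (by simp) (by simp) ?_ ?_
      fun i _ => (emits_print (by simp) (by simp) (by simp) ?_ ?_).congr ?_).congr ?_).congr
        ?_).seq emits_push).congr ?_
    rotate_right
    · rw [show [true] = List.replicate 1 true from rfl, List.replicate_append_replicate, threshold]
      congr 1
      simp [s₁, s₂, hn₁]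
      ring
    all_goals simp [s₁, s₂, h₁, h₂, h₃, h₄, hn₁, hn₂, hn₃, hnB, hkB]
  exact hthr.runs.cast rfl (by simp [s₁, s₂, hr])

/-- The value of a binary number whose most significant bit comes first. -/
def value (l : List Bool) : ℕ := l.foldl (fun v b => 2 * v + b.toNat) 0

theorem value_append (l : List Bool) (b : Bool) : value (l ++ [b]) = 2 * value l + b.toNat := by
  simp [value]

theorem value_take_le (l : List Bool) (i : ℕ) : value (l.take i) ≤ value l := by
  have h (m : List Bool) : ∀ l, value l ≤ value (l ++ m) := by
    induction m with
    | nil => simp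
    | cons b m ih =>
      intro l
      have := ih (l ++ [b])
      rw [List.append_assoc] at this
      refine le_trans ?_ this
      rw [value_append]
      omega
  simpa using h (l.drop i) (l.take i)

theorem value_encodeNat (d : ℕ) : value (Computability.encodeNat d).reverse = d := by
  have h (p : PosNum) : value (Computability.encodePosNum p).reverse = p := by
    induction p with
    | one => rfl
    | bit1 p ih =>
      rw [Computability.encodePosNum, List.reverse_cons, value_append, ih, PosNum.cast_bit1]
      simp; ring
    | bit0 p ih =>
      rw [Computability.encodePosNum, List.reverse_cons, value_append, ih, PosNum.cast_bit0]
      simp; ring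
  rw [Computability.encodeNat]
  conv_rhs => rw [← Num.to_of_nat d]
  rcases (d : Num) with _ | p
  · rfl
  · exact h p

theorem length_encodeNat_le (d : ℕ) : (Computability.encodeNat d).length ≤ d := by
  have h (p : PosNum) : (Computability.encodePosNum p).length ≤ p := by
    induction p with
    | one => rfl
    | bit1 p ih =>
      rw [Computability.encodePosNum, List.length_cons, PosNum.cast_bit1]; omega
    | bit0 p ih =>
      have : 0 < (p : ℕ) := PosNum.cast_pos p
      rw [Computability.encodePosNum, List.length_cons, PosNum.cast_bit0]; omega
  rw [Computability.encodeNat]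
  conv_rhs => rw [← Num.to_of_nat d]
  rcases (d : Num) with _ | p
  · rfl
  · exact h p

theorem runs_doubleCmd {m : ℕ} (h : s .acc = List.replicate m true) (h₁ : s .z₁ = [])
    (hB : 2 * m ≤ B) :
    Runs Q B doubleCmd s (update s .acc (List.replicate (2 * m) true)) := by
  refine Runs.seq (s' := update (update s .acc []) .z₁ (List.replicate (2 * m) true)) ?_ ?_
  · refine (runs_bits_const (by simp [h]; omega) (fun i => update (update s .acc
      (List.replicate (m - i) true)) .z₁ (List.replicate (2 * i) true)) ?_ ?_ fun i hi => ?_).cast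
        rfl ?_
    · simp [h]
    · funext r
      cases r <;> simp [h, h₁]
    · refine ((Runs.push ..).seq (.push ..)).cast rfl ?_
      funext r
      cases r <;> simp [h, Nat.mul_add, List.replicate_succ]
    · simp [h]
  · refine (runs_bits_const (by simp; omega) (fun i => update (update s .acc
      (List.replicate i true)) .z₁ (List.replicate (2 * m - i) true)) ?_ ?_ fun i hi => ?_).cast
        rfl ?_
    · simp
    · funext r
      cases r <;> simp
    · refine (Runs.push ..).cast rfl ?_
      funext r
      cases r <;> simp [List.replicate_succ]
    · funext r
      cases r <;> simp [h₁]

theorem runs_decodeCmd {d : ℕ} (h : s .out = (Computability.encodeNat d).reverse)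
    (ha : s .acc = []) (h₁ : s .z₁ = []) (hB : d ≤ B) :
    Runs Q B decodeCmd s (update (update s .out []) .acc (List.replicate d true)) := by
  have hv := value_encodeNat d
  rw [← h] at hv
  have hl : (s .out).length ≤ B := by
    rw [h, List.length_reverse]; exact (length_encodeNat_le d).trans hB
  refine (runs_bits (s .out) hl (fun i => update (update s .out ((s .out).drop i)) .acc
      (List.replicate (value ((s .out).take i)) true)) ?_ fun i hi => ?_).cast ?_ ?_
  · simp
  · have hle := value_take_le (s .out) (i + 1)
    rw [← List.take_concat_get' (s .out) i hi, value_append] at hle ⊢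
    have hd := runs_doubleCmd (Q := Q) (B := B) (s := update (update (update s .out
      ((s .out).drop i)) .acc (List.replicate (value ((s .out).take i)) true)) .out
        ((s .out).drop (i + 1))) (m := value ((s .out).take i)) (by simp) (by simp [h₁]) (by omega)
    cases hb : (s .out)[i] with
    | true =>
      refine hd.seq ((Runs.push ..).cast rfl ?_)
      funext r
      cases r <;> simp [List.replicate_succ]
    | false =>
      refine hd.cast rfl ?_
      funext r
      cases r <;> simp
  · funext r
    cases r <;> simp [ha, value]
  · rw [List.take_of_length_le le_rfl, hv]
    simp

theorem runs_compareCmd {d t : ℕ} (ha : s .acc = List.replicate d true)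
    (ht : s .thr = List.replicate t true) (ho : s .out = []) (hd : d ≤ B) (htB : t ≤ B) :
    Runs Q B compareCmd s
      (update (update (update s .acc []) .thr []) .out [decide (d < t)]) := by
  refine Runs.seq (s' := update (update s .acc []) .thr (List.replicate (t - d) true)) ?_
    (.seq (.push ..) ?_)
  · refine (runs_bits_const (by simp [ha, hd]) (fun i => update (update s .acc
      (List.replicate (d - i) true)) .thr (List.replicate (t - i) true)) ?_ ?_ fun i hi => ?_).cast
        rfl ?_
    · simp [ha]
    · funext r
      cases r <;> simp [ha, ht]
    · refine runs_drop.cast rfl ?_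
      funext r
      cases r <;> simp [ha, Nat.sub_sub]
    · simp [ha]
  · refine (runs_bits_const (by simp; omega) (fun i => update (update (update s .acc []) .thr
      (List.replicate (t - d - i) true)) .out [decide (0 < i)]) ?_ ?_ fun i hi => ?_).cast
        rfl ?_
    · simp
    · funext r
      cases r <;> simp [ho]
    · refine (runs_drop.seq (.push ..)).cast rfl ?_
      funext r
      cases r <;> simp [Nat.sub_sub]
    · funext r
      cases r <;> simp

theorem runs_isoCmd {A A' : ℕ → ℕ → Bool} {n d : ℕ} (hA : ∀ v, A v v = false)
    (hA' : ∀ v, A' v v = false)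
    (hQ : Q (unary (n + 3 * numCopies n * n) ++
        instanceWord A n (3 * numCopies n * n) (fun _ => List.range n) ++
        instanceWord A' n (3 * numCopies n * n) (rotation n)) (Computability.encodeNat d))
    (hB : (unary n ++ adjWord A n ++ adjWord A' n).length ≤ B)
    (hqB : (unary (n + 3 * numCopies n * n) ++
        instanceWord A n (3 * numCopies n * n) (fun _ => List.range n) ++
        instanceWord A' n (3 * numCopies n * n) (rotation n)).length ≤ B)
    (hdB : d ≤ B) (htB : threshold n ≤ B) :
    Runs Q B isoCmd (update (fun _ => []) .inp (unary n ++ adjWord A n ++ adjWord A' n))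
      (update (fun _ => []) .out [decide (d < threshold n)]) := by
  set M := 3 * numCopies n * n with hM
  have hMB : n + M ≤ B := by
    simp [unary] at hqB; omega
  have hkB : numCopies n ≤ B := by
    rcases Nat.eq_zero_or_pos n with h | h
    · subst h
      simp [threshold] at htB
      simpa [numCopies] using htB
    · refine le_trans ?_ htB
      have : 0 < n ^ 3 := by positivity
      rw [threshold]
      nlinarith
  set s₁ : Reg → List Bool := fun r => match r with
    | .inp => adjWord A n ++ adjWord A' n
    | .n₁ | .n₂ | .n₃ => List.replicate n true
    | _ => [] with hs₁
  have e₁ : Runs Q B parseCmd (update (fun _ => []) .inp (unary n ++ adjWord A n ++ adjWord A' n))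
      s₁ := by
    refine (runs_parseCmd (n := n) (l := adjWord A n ++ adjWord A' n) (by simp)
      (by simpa using hB)).cast rfl ?_
    funext r
    cases r <;> simp [s₁]
  refine e₁.seq ?_
  set s₂ : Reg → List Bool := fun r => match r with
    | .inp => adjWord A n ++ adjWord A' n
    | .n₁ | .n₂ | .n₃ => List.replicate n true
    | .copies => List.replicate (numCopies n) true
    | .todo => List.replicate M true
    | .thr => List.replicate (threshold n) true
    | _ => [] with hs₂
  have e₂ : Runs Q B sizesCmd s₁ s₂ := by
    refine (runs_sizesCmd (n := n) rfl rfl rfl rfl (by simp [s₁]) (by simp [s₁]) (by simp [s₁]) rfl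
      rfl rfl (by omega) hkB).cast rfl ?_
    funext r
    cases r <;> simp [s₁, s₂, M]
  refine e₂.seq ?_
  have e₃ : Emits Q B .out (print .out .n₁ .z₁ ;; name .todo) s₂ (unary (n + M)) := by
    refine ((emits_print (by simp) (by simp) (by simp) rfl (by simp [s₂]; omega)).seq
      (emits_name (by simp) (by simp) rfl (by simp [s₂]; omega))).congr ?_
    simp [s₂, unary_add]
  refine e₃.runs.seq ?_
  have e₄ := runs_instanceCmd (Q := Q) (B := B)
    (s := update s₂ .out ((unary (n + M)).reverse ++ []))
    (n := n) (k := numCopies n) hA (emitsVertices_increasing (by omega)) rfl rfl rfl rfl rfl rfl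
    (by simp [s₂]) (by simp [s₂]) (by simp [s₂]) (by simp [s₂, M]) rfl (by omega) hkB
    (by omega) (l := adjWord A' n) (by simp [s₂])
  refine e₄.seq ?_
  refine (runs_instanceCmd (n := n) (k := numCopies n) hA' (emitsVertices_rotation (by omega))
    rfl rfl rfl rfl rfl rfl (by simp [s₂]) (by simp [s₂]) (by simp [s₂]) (by simp [s₂, M]) rfl
    (by omega) hkB (by omega) (l := []) (by simp)).seq ?_
  refine (Runs.query hQ ?_ hqB ((length_encodeNat_le d).trans hdB)).seq ?_
  · simp [M]
  refine (runs_decodeCmd (d := d) (by simp) rfl rfl hdB).seq ?_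
  refine (runs_compareCmd (d := d) (t := threshold n) (by simp) (by simp [s₂]) (by simp) hdB
    htB).seq ?_
  refine (runs_clear ?_).seq ((runs_clear ?_).seq ((runs_clear ?_).seq ((runs_clear ?_).seq
    ((runs_clear ?_).cast rfl ?_))))
  iterate 5 simp [s₂]; omega
  funext r
  cases r <;> simp [s₂]

end

end StableRoommates

namespace StableRoommates

open Function

/-! ### Instances given by preference lists -/

/-- The lists `L a` are preference lists of the agents `0, …, N - 1`. -/
def IsPrefLists (N : ℕ) (L : ℕ → List ℕ) : Prop :=
  ∀ a < N, (L a).Nodup ∧ ∀ b, b ∈ L a ↔ b < N ∧ b ≠ a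

section

variable {N : ℕ} {L L' : ℕ → List ℕ}

theorem IsPrefLists.mem (h : IsPrefLists N L) {a : Fin N} (b : {b : Fin N // b ≠ a}) :
    (b : ℕ) ∈ L a :=
  ((h a a.2).2 b).2 ⟨b.1.2, fun e => b.2 (Fin.ext e)⟩

theorem IsPrefLists.injective (h : IsPrefLists N L) (a : Fin N) :
    Injective fun b : {b : Fin N // b ≠ a} => (L a).idxOf (b : ℕ) :=
  fun b _ e => Subtype.ext (Fin.ext ((List.idxOf_inj (h.mem b)).1 e))

/-- The instance with the given preference lists. -/
def ofLists (h : IsPrefLists N L) : SRInstance (Fin N) where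
  pref a := LinearOrder.lift' (fun b => (L a).idxOf (b : ℕ)) (h.injective a)

theorem IsPrefLists.length (h : IsPrefLists N L) (a : Fin N) : (L a).length = N - 1 := by
  have : (L a).toFinset = (Finset.range N).erase a := by
    ext b
    simp [(h a a.2).2, and_comm]
  rw [← List.toFinset_card_of_nodup (h a a.2).1, this,
    Finset.card_erase_of_mem (Finset.mem_range.2 a.2), Finset.card_range]

theorem pairwise_ranking {X : Type*} [Fintype X] (o : LinearOrder X) :
    (ranking o).Pairwise o.le :=
  let _ := o
  Finset.pairwise_sort _ _

theorem nodup_ranking {X : Type*} [Fintype X] (o : LinearOrder X) : (ranking o).Nodup :=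
  let _ := o
  Finset.sort_nodup _ _

theorem mem_ranking {X : Type*} [Fintype X] (o : LinearOrder X) (x : X) : x ∈ ranking o :=
  let _ := o
  (Finset.mem_sort _).2 (Finset.mem_univ _)

theorem pos_lift {X : Type*} [Fintype X] (f : X → ℕ) (hf : Injective f) (x : X) :
    pos (LinearOrder.lift' f hf) x = (Finset.univ.filter fun y => f y < f x).card + 1 := by
  let _ := LinearOrder.lift' f hf
  exact congrArg (· + 1) (congrArg Finset.card (Finset.filter_congr_decidable ..))

theorem map_prefList (h : IsPrefLists N L) (a : Fin N) :
    ((ofLists h).prefList a).map (fun b : {b : Fin N // b ≠ a} => (b.1 : ℕ)) = L a := by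
  refine List.Perm.eq_of_pairwise (le := fun x y => (L a).idxOf x ≤ (L a).idxOf y) ?_ ?_ ?_ ?_
  · intro x y _ hy hxy hyx
    exact ((List.idxOf_inj hy).1 (hyx.antisymm hxy)).symm
  · rw [List.pairwise_map]
    exact pairwise_ranking ((ofLists h).pref a)
  · rw [List.pairwise_iff_getElem]
    intro i j hi hj hij
    rw [(h a a.2).1.idxOf_getElem, (h a a.2).1.idxOf_getElem]
    exact hij.le
  · refine (List.perm_ext_iff_of_nodup ?_ (h a a.2).1).2 fun b => ?_
    · exact (nodup_ranking ((ofLists h).pref a)).map fun b c e => Subtype.ext (Fin.ext e)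
    · rw [(h a a.2).2, List.mem_map]
      constructor
      · rintro ⟨c, -, rfl⟩
        exact ⟨c.1.2, fun e => c.2 (Fin.ext e)⟩
      · rintro ⟨hb, hba⟩
        exact ⟨⟨⟨b, hb⟩, fun e => hba (congrArg Fin.val e)⟩,
          mem_ranking ((ofLists h).pref _) _, rfl⟩

theorem encode_ofLists (h : IsPrefLists N L) :
    (ofLists h).encode = (List.range N).flatMap fun a => codeList (L a) := by
  rw [SRInstance.encode, ← List.map_coe_finRange_eq_range, List.flatMap_map]
  refine List.flatMap_congr fun a _ => ?_
  rw [← map_prefList h a, codeList, List.flatMap_map]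
  simp

theorem pos_ofLists (h : IsPrefLists N L) (a : Fin N) (b : {b : Fin N // b ≠ a}) :
    pos ((ofLists h).pref a) b = (L a).idxOf (b : ℕ) + 1 := by
  rw [ofLists, pos_lift]
  congr 1
  have hb := List.idxOf_lt_length_iff.2 (h.mem b)
  refine Eq.trans ?_ (Finset.card_range ((L a).idxOf (b : ℕ)))
  refine Finset.card_bij (fun c _ => (L a).idxOf (c : ℕ)) ?_ ?_ ?_
  · intro c hc
    exact Finset.mem_range.2 (Finset.mem_filter.1 hc).2
  · exact fun c _ c' _ e => h.injective a e
  · intro i hi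
    have hi := Finset.mem_range.1 hi
    have hmem := ((h a a.2).2 _).1 (List.getElem_mem (hi.trans hb))
    have e := (h a a.2).1.idxOf_getElem i (hi.trans hb)
    refine ⟨⟨⟨_, hmem.1⟩, fun e => hmem.2 (congrArg Fin.val e)⟩, ?_, e⟩
    refine Finset.mem_filter.2 ⟨Finset.mem_univ _, ?_⟩
    exact e.trans_lt hi

theorem pos_relabel {X Y : Type*} [Fintype X] [Fintype Y] (e : X ≃ Y) (o : LinearOrder X) (x : X) :
    pos (relabel e o) (e x) = pos o x := by
  let _ := o
  let _ := relabel e o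
  have hlt : ∀ y z : Y, y < z ↔ e.symm y < e.symm z := fun _ _ => Iff.rfl
  refine congrArg (· + 1) (Finset.card_bij (fun y _ => e.symm y) ?_ ?_ ?_)
  · intro y hy
    simpa [hlt] using hy
  · exact fun y _ y' _ h => e.symm.injective h
  · intro y hy
    exact ⟨e y, by simpa [hlt] using hy, e.symm_apply_apply y⟩

/-- The cost of a bijection, with every agent put at the end of its own preference list. -/
theorem spearCost_ofLists (h : IsPrefLists N L) (h' : IsPrefLists N L') (σ : Fin N ≃ Fin N) :
    (spearCost (ofLists h) (ofLists h') σ : ℤ) = ∑ a : Fin N, ∑ b : Fin N,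
      |((L a).idxOf (b : ℕ) : ℤ) - ((L' (σ a)).idxOf (σ b : ℕ) : ℤ)| := by
  rw [spearCost, Nat.cast_sum]
  refine Finset.sum_congr rfl fun a _ => ?_
  rw [spear, ← (othersEquiv σ a).sum_comp, Nat.cast_sum]
  have hself : |((L a).idxOf (a : ℕ) : ℤ) - ((L' (σ a)).idxOf (σ a : ℕ) : ℤ)| = 0 := by
    rw [List.idxOf_of_notMem fun hm => (((h a a.2).2 _).1 hm).2 rfl,
      List.idxOf_of_notMem fun hm => (((h' _ (σ a).2).2 _).1 hm).2 rfl, h.length, h'.length]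
    simp
  rw [← Finset.sum_erase (f := fun b : Fin N =>
      |((L a).idxOf (b : ℕ) : ℤ) - ((L' (σ a)).idxOf (σ b : ℕ) : ℤ)|) _ hself,
    Finset.sum_subtype (p := fun b => b ≠ a) _ (by simp)
      (fun b => |((L a).idxOf (b : ℕ) : ℤ) - ((L' (σ a)).idxOf (σ b : ℕ) : ℤ)|)]
  refine Finset.sum_congr rfl fun b _ => ?_
  rw [pos_relabel, pos_ofLists, pos_ofLists, Int.natCast_natAbs]
  congr 1
  push_cast
  simp [othersEquiv]

end

end StableRoommates

namespace StableRoommates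

open Finset

/-! ### Sums over dummies -/

theorem sum_range_mul {M : Type*} [AddCommMonoid M] (f : ℕ → M) (k n : ℕ) :
    ∑ i ∈ range (k * n), f i = ∑ q ∈ range k, ∑ r ∈ range n, f (q * n + r) := by
  induction k with
  | zero => simp
  | succ k ih => rw [Nat.succ_mul, sum_range_add, ih, sum_range_succ]

theorem sum_mod (f : ℕ → ℤ) (k n : ℕ) :
    ∑ i ∈ range (k * n), f (i % n) = k * ∑ r ∈ range n, f r := by
  rw [sum_range_mul]
  trans ∑ q ∈ range k, ∑ r ∈ range n, f r
  · refine sum_congr rfl fun q _ => sum_congr rfl fun r hr => ?_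
    rw [Nat.mul_add_mod', Nat.mod_eq_of_lt (mem_range.1 hr)]
  · simp

/-- A third of the dummies puts the vertices in front. -/
theorem sum_isTop (s n : ℕ) (x y : ℤ) :
    ∑ i : Fin (3 * s * n), (if isTop n i then x else y) = s * n * (x + 2 * y) := by
  rw [Fin.sum_univ_eq_sum_range fun i => if isTop n i then x else y, sum_range_mul]
  trans ∑ q ∈ range (3 * s), n * (if q % 3 = 0 then x else y)
  · refine sum_congr rfl fun q _ => ?_
    trans ∑ r ∈ range n, if q % 3 = 0 then x else y
    · refine sum_congr rfl fun r hr => ?_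
      have hr := mem_range.1 hr
      rw [isTop, mul_comm, Nat.mul_add_div (by omega), Nat.div_eq_of_lt hr]
      simp
    · simp
  · induction s with
    | zero => simp
    | succ s ih =>
      rw [Nat.mul_succ, sum_range_succ, sum_range_succ, sum_range_succ, ih]
      simp [Nat.add_mod]
      ring

/-- Averaged over all rotations, every vertex takes every position equally often. -/
theorem sum_rotation (f : ℕ → ℤ) {n b : ℕ} (hb : b < n) :
    ∑ r ∈ range n, f ((b + (n - r)) % n) = ∑ c ∈ range n, f c := by
  -- `r ↦ b - r` is an involution modulo `n`.
  have h : ∀ r < n, (b + (n - (b + (n - r)) % n)) % n = r := by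
    intro r hr
    -- The two cases are those of `b + (n - r)` with and without wrapping around.
    rcases le_or_gt r b with h | h
    · rw [show b + (n - r) = b - r + n by omega, Nat.add_mod_right,
        Nat.mod_eq_of_lt (show b - r < n by omega), show b + (n - (b - r)) = r + n by omega,
        Nat.add_mod_right, Nat.mod_eq_of_lt hr]
    · rw [Nat.mod_eq_of_lt (show b + (n - r) < n by omega),
        show b + (n - (b + (n - r))) = r by omega, Nat.mod_eq_of_lt hr]
  have hlt : ∀ r, (b + (n - r)) % n < n := fun r => Nat.mod_lt _ (by omega)
  refine sum_nbij' (fun r => (b + (n - r)) % n) (fun r => (b + (n - r)) % n) ?_ ?_ ?_ ?_ ?_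
  · exact fun r _ => mem_range.2 (hlt r)
  · exact fun r _ => mem_range.2 (hlt r)
  · exact fun r hr => h r (mem_range.1 hr)
  · exact fun r hr => h r (mem_range.1 hr)
  · exact fun _ _ => rfl

theorem two_mul_sum_abs_sub {k n : ℕ} (h : k ≤ n) :
    2 * ∑ a ∈ range k, |(a : ℤ) - n| = k * (2 * n - k + 1) := by
  induction k with
  | zero => simp
  | succ k ih =>
    rw [sum_range_succ, mul_add, ih (by omega), abs_of_nonpos (by omega)]
    push_cast
    ring

theorem three_mul_sum_abs_sub (n : ℕ) :
    3 * ∑ a ∈ range n, ∑ c ∈ range n, |(a : ℤ) - c| = n ^ 3 - n := by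
  induction n with
  | zero => simp
  | succ n ih =>
    have h := two_mul_sum_abs_sub (le_refl n)
    have h' : ∑ c ∈ range n, |((n : ℕ) : ℤ) - c| = ∑ c ∈ range n, |(c : ℤ) - n| :=
      sum_congr rfl fun c _ => abs_sub_comm _ _
    simp only [sum_range_succ, sum_add_distrib, h', mul_add, ih, sub_self, abs_zero]
    push_cast
    linear_combination 3 * h

/-- The total Spearman distance between the orders in which the dummies rank the vertices does not
depend on how the vertices are matched. -/
theorem sum_rank_sub {n s : ℕ} (α : Equiv.Perm (Fin n)) :
    ∑ j : Fin (3 * s * n), ∑ w : Fin n, |(w : ℤ) - (((α w + (n - j % n)) % n : ℕ) : ℤ)| =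
      s * (n ^ 3 - n) := by
  rw [sum_comm, ← three_mul_sum_abs_sub, ← Fin.sum_univ_eq_sum_range
    (fun a => ∑ c ∈ range n, |(a : ℤ) - c|), mul_left_comm, ← mul_assoc, mul_sum]
  refine sum_congr rfl fun w _ => ?_
  rw [Fin.sum_univ_eq_sum_range fun j : ℕ => |(w : ℤ) - (((α w + (n - j % n)) % n : ℕ) : ℤ)|,
    sum_mod (fun r => |(w : ℤ) - (((α w + (n - r) : ℕ) % n : ℕ) : ℤ)|),
    sum_rotation (fun c => |(w : ℤ) - (c : ℤ)|) (α w).2]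
  push_cast
  ring

end StableRoommates

namespace StableRoommates

open Finset Sum

/-! ### The cost of a bijection between two instances of the reduction -/

section

variable {n M s : ℕ} {A A' : Fin n → Fin n → Bool} {ρ ρ' : Fin M → Fin n → ℕ}
  {P P' : Fin n ⊕ Fin M → Fin n ⊕ Fin M → ℤ}

/-- `P a b` is the number of agents that `a` prefers to `b` (with `a` itself behind all others), in
an instance of the reduction from the graph `A`, where the `j`-th dummy ranks the vertices by
`ρ j`.  The vertices are `inl v`, the dummies are `inr i`. -/
structure IsLayout (A : Fin n → Fin n → Bool) (ρ : Fin M → Fin n → ℕ)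
    (P : Fin n ⊕ Fin M → Fin n ⊕ Fin M → ℤ) : Prop where
  adj {v w} : A v w = true → 0 ≤ P (inl v) (inl w) ∧ P (inl v) (inl w) < n
  nonadj {v w} : A v w = false → M ≤ P (inl v) (inl w) ∧ P (inl v) (inl w) < M + n
  vertex_dummy (v i) : P (inl v) (inr i) = #{w | A v w = true} + i
  dummy_vertex (j w) : P (inr j) (inl w) = (if isTop n j then 0 else (M : ℤ) - 1) + ρ j w
  dummy_dummy {j i} : j ≠ i →
    P (inr j) (inr i) = (if isTop n j then (n : ℤ) else 0) + i - if j < i then 1 else 0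
  self (i) : P (inr i) (inr i) = n + M - 1
  lt (j w) : ρ j w < n

/-- The cost of a bijection, as a sum over all pairs of agents. -/
def cost (P P' : Fin n ⊕ Fin M → Fin n ⊕ Fin M → ℤ) (σ : Equiv.Perm (Fin n ⊕ Fin M)) : ℤ :=
  ∑ a, ∑ b, |P a b - P' (σ a) (σ b)|

/-- For an isomorphism, only the dummies' opinions on the vertices and the order among the
neighbours or the non-neighbours of a vertex contribute to the cost. -/
theorem cost_sumCongr_one_le (h : IsLayout A ρ P) (h' : IsLayout A' ρ' P')
    (α : Equiv.Perm (Fin n)) (hα : ∀ v w, A v w = A' (α v) (α w)) :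
    cost P P' (α.sumCongr 1) ≤ ∑ j, ∑ w, |(ρ j w : ℤ) - ρ' j (α w)| + n ^ 3 := by
  have hdeg : ∀ v, #{w | A v w = true} = #{w | A' (α v) w = true} := fun v =>
    card_equiv α (by simp [hα])
  have h₁ : ∀ v w, |P (inl v) (inl w) - P' (inl (α v)) (inl (α w))| ≤ n := by
    intro v w
    rw [abs_le]
    cases e : A v w
    · have h₁ := h.nonadj e
      have h₂ := h'.nonadj ((hα v w).symm.trans e)
      constructor <;> omega
    · have h₁ := h.adj e
      have h₂ := h'.adj ((hα v w).symm.trans e)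
      constructor <;> omega
  have h₂ : ∀ v i, |P (inl v) (inr i) - P' (inl (α v)) (inr i)| = 0 := by
    intro v i
    rw [h.vertex_dummy, h'.vertex_dummy, hdeg]
    simp
  have h₃ : ∀ j w, |P (inr j) (inl w) - P' (inr j) (inl (α w))| = |(ρ j w : ℤ) - ρ' j (α w)| := by
    intro j w
    rw [h.dummy_vertex, h'.dummy_vertex]
    simp
  have h₄ : ∀ j i, |P (inr j) (inr i) - P' (inr j) (inr i)| = 0 := by
    intro j i
    rcases eq_or_ne j i with rfl | hij
    · simp [h.self, h'.self]
    · simp [h.dummy_dummy hij, h'.dummy_dummy hij]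
  have h₅ : ∑ v, ∑ w, |P (inl v) (inl w) - P' (inl (α v)) (inl (α w))| ≤ n ^ 3 := by
    calc _ ≤ ∑ v : Fin n, ∑ w : Fin n, (n : ℤ) := sum_le_sum fun v _ => sum_le_sum fun w _ => h₁ v w
      _ = n ^ 3 := by simp; ring
  simp only [cost, Fintype.sum_sum_type, Equiv.sumCongr_apply, Sum.map_inl, Sum.map_inr,
    Equiv.Perm.coe_one, id, h₂, h₃, h₄, sum_const_zero, add_zero]
  linarith

/-- If a vertex is matched with the `k`-th dummy, then its position in the list of a dummy changes
by at least `k - n` if the dummy puts the vertices in front, and by at least `M - 1 - k - n`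
otherwise. -/
theorem le_cost_of_inl_eq_inr (h : IsLayout A ρ P) (h' : IsLayout A' ρ' P') (hM : M = 3 * s * n)
    {σ : Equiv.Perm (Fin n ⊕ Fin M)} {w : Fin n} {k : Fin M} (hσ : σ (inl w) = inr k) :
    (s * n * (M - 1 - 3 * n) : ℤ) ≤ cost P P' σ := by
  have hk : ∀ a ≠ inr k, k - 1 ≤ P' a (inr k) ∧ P' a (inr k) ≤ k + n := by
    rintro (v | j) ha
    · rw [h'.vertex_dummy]
      have := card_filter_le univ fun w => A' v w = true
      rw [card_univ, Fintype.card_fin] at this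
      omega
    · rw [h'.dummy_dummy (by simpa using ha)]
      split_ifs <;> omega
  calc (s * n * (M - 1 - 3 * n) : ℤ)
      ≤ s * n * (((k : ℤ) - n) + 2 * (M - 1 - k - n)) := by
        refine mul_le_mul_of_nonneg_left ?_ (by positivity)
        have := k.2
        omega
    _ = ∑ j : Fin M, if isTop n j then (k : ℤ) - n else M - 1 - k - n := by
        subst hM
        rw [sum_isTop]
    _ ≤ ∑ j : Fin M, |P (inr j) (inl w) - P' (σ (inr j)) (σ (inl w))| := by
        refine sum_le_sum fun j _ => ?_
        have hj := hk (σ (inr j)) fun e => by simpa using σ.injective (e.trans hσ.symm)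
        have hρ := h.lt j w
        rw [h.dummy_vertex, hσ]
        split_ifs
        · refine le_trans ?_ (neg_le_abs _)
          omega
        · refine le_trans ?_ (le_abs_self _)
          omega
    _ ≤ ∑ j : Fin M, ∑ b, |P (inr j) b - P' (σ (inr j)) (σ b)| :=
        sum_le_sum fun j _ => single_le_sum
          (f := fun b => |P (inr j) b - P' (σ (inr j)) (σ b)|) (fun _ _ => abs_nonneg _)
          (mem_univ (inl w))
    _ ≤ cost P P' σ := by
        rw [cost, Fintype.sum_sum_type]
        exact le_add_of_nonneg_left (sum_nonneg fun _ _ => sum_nonneg fun _ _ => abs_nonneg _)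

/-- The sum of the positions of the `i`-th dummy. -/
theorem IsLayout.sum_dummy (h : IsLayout A ρ P) (i : Fin M) :
    ∑ j, P (inr j) (inr i) = (∑ j : Fin M, if isTop n j then (n : ℤ) else 0) + n + M - 1 +
      (i * (M - 2) - if isTop n i then (n : ℤ) else 0) := by
  -- One formula for all `j`, with a correction at `j = i`.
  have hP : ∀ j, P (inr j) (inr i) = (if isTop n j then (n : ℤ) else 0) + i -
      (if j < i then 1 else 0) +
      if j = i then n + M - 1 - i - (if isTop n i then (n : ℤ) else 0) else 0 := by
    intro j
    rcases eq_or_ne j i with rfl | hij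
    · rw [h.self]
      simp
      ring
    · rw [h.dummy_dummy hij]
      simp [hij]
  have hc : #{j | j < i} = (i : ℕ) := by
    rw [← Fin.card_Iio i]
    congr 1
    ext
    simp
  simp only [hP, sum_add_distrib, sum_sub_distrib, sum_ite_eq', mem_univ, if_true, sum_const,
    card_univ, Fintype.card_fin, sum_boole, hc, nsmul_eq_mul]
  ring

/-- A dummy cannot save cost by taking the place of another dummy: as the sum of its positions over
all dummies changes by more than `M - 2 - n`, this costs at least as much as it can save at the
vertices. -/
theorem le_sum_column (h : IsLayout A ρ P) (h' : IsLayout A' ρ' P')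
    (hM : (n : ℤ) + n ^ 2 + 2 ≤ M) (α : Equiv.Perm (Fin n))
    (τ : Equiv.Perm (Fin M)) (i : Fin M) :
    ∑ w, |(ρ i w : ℤ) - ρ' i (α w)| ≤
      ∑ w, |P (inr i) (inl w) - P' (inr (τ i)) (inl (α w))| +
        ∑ j, |P (inr j) (inr i) - P' (inr (τ j)) (inr (τ i))| := by
  by_cases hi : τ i = i
  · rw [hi]
    refine le_add_of_le_of_nonneg (sum_le_sum fun w _ => ?_) (sum_nonneg fun _ _ => abs_nonneg _)
    rw [h.dummy_vertex, h'.dummy_vertex]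
    simp
  · have h₁ : ∑ w, |(ρ i w : ℤ) - ρ' i (α w)| ≤ n ^ 2 := by
      calc _ ≤ ∑ w : Fin n, (n : ℤ) := sum_le_sum fun w _ => by
            have := h.lt i w
            have := h'.lt i (α w)
            rw [abs_le]
            constructor <;> omega
        _ = n ^ 2 := by simp; ring
    have h₂ : 0 ≤ ∑ w, |P (inr i) (inl w) - P' (inr (τ i)) (inl (α w))| :=
      sum_nonneg fun _ _ => abs_nonneg _
    have h₃ := abs_sum_le_sum_abs (fun j => P (inr j) (inr i) - P' (inr (τ j)) (inr (τ i))) univ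
    rw [sum_sub_distrib, Equiv.sum_comp τ fun j => P' (inr j) (inr (τ i)), h.sum_dummy,
      h'.sum_dummy] at h₃
    have h₄ : (M : ℤ) - 2 ≤ |(i : ℤ) * (M - 2) - (τ i : ℤ) * (M - 2)| := by
      rw [← sub_mul, abs_mul]
      have : 1 ≤ |(i : ℤ) - τ i| := Int.one_le_abs (sub_ne_zero.2 fun e => hi (Fin.ext (by omega)))
      exact (le_abs_self _).trans (le_mul_of_one_le_left (abs_nonneg _) this)
    have h₅ : |((i : ℤ) * (M - 2) - (τ i : ℤ) * (M - 2))| - n ≤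
        |((i : ℤ) * (M - 2) - if isTop n i then (n : ℤ) else 0) -
          ((τ i : ℤ) * (M - 2) - if isTop n (τ i) then (n : ℤ) else 0)| := by
      have hn :
          |(if isTop n i then (n : ℤ) else 0) - if isTop n (τ i) then (n : ℤ) else 0| ≤ n := by
        split_ifs <;> simp
      rw [sub_le_iff_le_add]
      refine le_trans ?_ (add_le_add_right hn _)
      refine le_trans (le_of_eq ?_) (abs_add_le _ _)
      congr 1
      ring
    rw [add_sub_add_left_eq_sub] at h₃
    linarith

/-- A matching of vertices with vertices costs at least as much as if all dummies were fixed, apart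
from the vertices' opinions on dummies. -/
theorem le_cost_sumCongr (h : IsLayout A ρ P) (h' : IsLayout A' ρ' P')
    (hM : (n : ℤ) + n ^ 2 + 2 ≤ M) (α : Equiv.Perm (Fin n)) (τ : Equiv.Perm (Fin M)) :
    ∑ j, ∑ w, |(ρ j w : ℤ) - ρ' j (α w)| +
      ∑ v, ∑ w, |P (inl v) (inl w) - P' (inl (α v)) (inl (α w))| ≤ cost P P' (α.sumCongr τ) := by
  have := sum_le_sum fun i (_ : i ∈ univ) => le_sum_column h h' hM α τ i
  rw [sum_add_distrib,
    sum_comm (f := fun i j => |P (inr j) (inr i) - P' (inr (τ j)) (inr (τ i))|)] at this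
  have h₀ : 0 ≤ ∑ v, ∑ i, |P (inl v) (inr i) - P' (inl (α v)) (inr (τ i))| :=
    sum_nonneg fun _ _ => sum_nonneg fun _ _ => abs_nonneg _
  simp only [cost, Fintype.sum_sum_type, Equiv.sumCongr_apply, Sum.map_inl, Sum.map_inr,
    sum_add_distrib]
  linarith

/-- If the dummies' total disagreement about the vertices is `s * (n ^ 3 - n)` for every matching of
the vertices, then some bijection costs less than the threshold if and only if the graphs are
isomorphic. -/
theorem exists_cost_lt_iff (hM : M = 3 * s * n) (hs : s = 2 * n ^ 2 + 1) (h : IsLayout A ρ P)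
    (h' : IsLayout A' ρ' P')
    (hρ : ∀ α : Equiv.Perm (Fin n),
      ∑ j, ∑ w, |(ρ j w : ℤ) - ρ' j (α w)| = s * (n ^ 3 - n)) :
    (∃ σ, cost P P' σ < s * n ^ 3 + 1) ↔
      ∃ α : Equiv.Perm (Fin n), ∀ v w, A v w = A' (α v) (α w) := by
  have hM' : (M : ℤ) = 3 * (2 * n ^ 2 + 1) * n := by
    rw [hM, hs]
    push_cast
    ring
  have hs' : (s : ℤ) = 2 * n ^ 2 + 1 := by
    rw [hs]
    push_cast
    ring
  constructor
  · rintro ⟨σ, hσ⟩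
    rcases Nat.eq_zero_or_pos n with rfl | hn
    · exact ⟨1, fun v => v.elim0⟩
    have hn : (1 : ℤ) ≤ n := by exact_mod_cast hn
    have hn₂ : (n : ℤ) ≤ n ^ 2 := by nlinarith
    have hn₃ : (n : ℤ) ^ 2 ≤ n ^ 3 := by nlinarith
    by_cases hv : ∃ w k, σ (inl w) = inr k
    · obtain ⟨w, k, hw⟩ := hv
      have := le_cost_of_inl_eq_inr h h' hM hw
      have hsn : (0 : ℤ) < s * n := mul_pos (by rw [hs']; positivity) (by omega)
      exfalso
      rw [hM'] at this
      nlinarith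
    · have hmaps : Set.MapsTo σ (Set.range (inl : Fin n → Fin n ⊕ Fin M)) (Set.range inl) := by
        rintro _ ⟨w, rfl⟩
        rcases e : σ (inl w) with v | k
        · exact ⟨v, rfl⟩
        · exact (hv ⟨w, k, e⟩).elim
      obtain ⟨⟨α, τ⟩, rfl⟩ := Equiv.Perm.mem_sumCongrHom_range_of_perm_mapsTo_inl hmaps
      change cost P P' (α.sumCongr τ) < _ at hσ
      have hcost := le_cost_sumCongr h h' (by rw [hM']; nlinarith) α τ
      rw [hρ] at hcost
      have h₂ : ∀ v w, 0 ≤ |P (inl v) (inl w) - P' (inl (α v)) (inl (α w))| :=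
        fun _ _ => abs_nonneg _
      refine ⟨α, fun v w => ?_⟩
      by_contra hne
      -- A neighbour is in front of all dummies, a non-neighbour behind them.
      have h₃ : (M : ℤ) - n ≤ |P (inl v) (inl w) - P' (inl (α v)) (inl (α w))| := by
        cases e : A v w <;> cases e' : A' (α v) (α w)
        · exact (hne (e.trans e'.symm)).elim
        · have h₁ := h.nonadj e
          have h₂ := h'.adj e'
          refine le_trans ?_ (le_abs_self _)
          omega
        · have h₁ := h.adj e
          have h₂ := h'.nonadj e'
          refine le_trans ?_ (neg_le_abs _)
          omega
        · exact (hne (e.trans e'.symm)).elim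
      have h₄ := h₃.trans (single_le_sum (fun w _ => h₂ v w) (mem_univ w))
      have h₅ := h₄.trans (single_le_sum
        (f := fun v => ∑ w, |P (inl v) (inl w) - P' (inl (α v)) (inl (α w))|)
        (fun v _ => sum_nonneg fun w _ => h₂ v w) (mem_univ v))
      rw [hM'] at h₅
      rw [hs'] at hcost hσ
      nlinarith
  · rintro ⟨α, hα⟩
    refine ⟨α.sumCongr 1, (cost_sumCongr_one_le h h' α hα).trans_lt ?_⟩
    rw [hρ, hs']
    have : (0 : ℤ) ≤ n := by positivity
    have : (0 : ℤ) ≤ n ^ 3 := by positivity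
    nlinarith

end

end StableRoommates

namespace StableRoommates

open Function Sum

/-! ### Positions in the preference lists of the reduction -/

theorem idxOf_map_range {f : ℕ → ℕ} (hf : Injective f) {j k : ℕ} (h : j < k) :
    ((List.range k).map f).idxOf (f j) = j := by
  have hn : ((List.range k).map f).Nodup := List.nodup_range.map hf
  have := hn.idxOf_getElem j (by simpa using h)
  simpa using this

theorem idxOf_range {j k : ℕ} (h : j < k) : (List.range k).idxOf j = j := by
  simpa using idxOf_map_range injective_id h

section Dummies

variable {n M i j : ℕ}

theorem mem_otherDummies (hi : i < M) {x : ℕ} :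
    x ∈ otherDummies n M i ↔ n ≤ x ∧ x < n + M ∧ x ≠ n + i := by
  simp only [otherDummies, List.mem_append, List.mem_map, List.mem_range]
  constructor
  · rintro (⟨j, hj, rfl⟩ | ⟨j, hj, rfl⟩) <;> omega
  · rintro ⟨h₁, h₂, h₃⟩
    rcases lt_or_ge x (n + i) with h | h
    · exact .inl ⟨x - n, by omega, by omega⟩
    · exact .inr ⟨x - n - i - 1, by omega, by omega⟩

theorem nodup_otherDummies : (otherDummies n M i).Nodup := by
  refine List.Nodup.append (List.nodup_range.map (add_right_injective _))
    (List.nodup_range.map (add_right_injective _)) ?_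
  simp only [List.disjoint_left, List.mem_map, List.mem_range]
  rintro _ ⟨j, hj, rfl⟩ ⟨k, hk, h⟩
  omega

theorem length_otherDummies (hi : i < M) : (otherDummies n M i).length = M - 1 := by
  simp [otherDummies]
  omega

theorem idxOf_otherDummies (hj : j < M) (hij : i ≠ j) :
    ((otherDummies n M i).idxOf (n + j) : ℤ) = j - if i < j then 1 else 0 := by
  rcases lt_or_gt_of_ne hij with h | h
  · rw [otherDummies, List.idxOf_append_of_notMem, if_pos h,
      show n + j = n + i + 1 + (j - i - 1) by omega,
      idxOf_map_range (add_right_injective _) (by omega)]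
    · simp
      omega
    · simp
      omega
  · rw [otherDummies, List.idxOf_append_of_mem (by simpa using h),
      idxOf_map_range (add_right_injective _) h, if_neg (by omega)]
    simp

end Dummies

section Rows

variable {A : ℕ → ℕ → Bool} {n M : ℕ} {V : ℕ → List ℕ}

theorem nodup_vertexRow (v : ℕ) : (vertexRow A n M v).Nodup := by
  have h : (List.range n).reverse.Nodup := List.nodup_reverse.2 List.nodup_range
  refine ((h.filter _).append (List.nodup_range.map (add_right_injective _)) ?_).append
    (h.filter _) ?_
  · simp only [List.disjoint_left, List.mem_map, List.mem_filter, List.mem_reverse, List.mem_range]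
    rintro w ⟨hw, -⟩ ⟨k, hk, h⟩
    omega
  · simp only [List.disjoint_left, List.mem_map, List.mem_filter, List.mem_reverse, List.mem_range,
      List.mem_append]
    rintro w (⟨hw, h₁⟩ | ⟨k, hk, h⟩) ⟨h₂, h₃⟩
    · simp [h₁] at h₃
    · omega

theorem mem_vertexRow {v : ℕ} (hA : A v v = false) (hv : v < n) (w : ℕ) :
    w ∈ vertexRow A n M v ↔ w < n + M ∧ w ≠ v := by
  simp only [vertexRow, List.mem_map, List.mem_filter, List.mem_reverse, List.mem_range,
      List.mem_append]
  constructor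
  · rintro ((⟨hw, h₁⟩ | ⟨k, hk, rfl⟩) | ⟨hw, h₁⟩)
    · exact ⟨by omega, by rintro rfl; simp [hA] at h₁⟩
    · omega
    · simp at h₁
      omega
  · rintro ⟨hw, hwv⟩
    rcases lt_or_ge w n with h | h
    · cases e : A v w
      · exact .inr ⟨h, by simp [hwv]⟩
      · exact .inl (.inl ⟨h, rfl⟩)
    · exact .inl (.inr ⟨w - n, by omega, by omega⟩)

theorem nodup_dummyRow {l : List ℕ} (hl : l.Nodup) (hl' : ∀ w, w ∈ l ↔ w < n) {i : ℕ}
    (hi : i < M) : (dummyRow n M l i).Nodup := by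
  have h : l.Disjoint (otherDummies n M i) := by
    simp only [List.disjoint_left, hl', mem_otherDummies hi]
    omega
  unfold dummyRow
  cases isTop n i
  · exact nodup_otherDummies.append hl h.symm
  · exact hl.append nodup_otherDummies h

theorem mem_dummyRow {l : List ℕ} (hl : ∀ w, w ∈ l ↔ w < n) {i : ℕ} (hi : i < M) (w : ℕ) :
    w ∈ dummyRow n M l i ↔ w < n + M ∧ w ≠ n + i := by
  unfold dummyRow
  cases isTop n i <;> simp only [cond, List.mem_append, hl, mem_otherDummies hi] <;> omega

theorem mod_lt_of_dvd (hM : n ∣ M) {i : ℕ} (hi : i < M) : i % n < n := by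
  refine Nat.mod_lt _ (Nat.pos_of_ne_zero ?_)
  rintro rfl
  rw [Nat.zero_dvd.1 hM] at hi
  exact Nat.not_lt_zero _ hi

theorem isPrefLists_agentRow (hM : n ∣ M) (hA : ∀ v, A v v = false)
    (hV : ∀ r < n, (V r).Nodup ∧ ∀ w, w ∈ V r ↔ w < n) :
    IsPrefLists (n + M) (agentRow A n M V) := by
  intro a ha
  unfold agentRow
  split_ifs with h
  · exact ⟨nodup_vertexRow a, mem_vertexRow (hA a) h⟩
  · have hV := hV _ (mod_lt_of_dvd hM (show a - n < M by omega))
    refine ⟨nodup_dummyRow hV.1 hV.2 (by omega), fun b => ?_⟩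
    rw [mem_dummyRow hV.2 (by omega), show n + (a - n) = a by omega]

theorem length_filter_reverse_range (p : ℕ → Bool) :
    ((List.range n).reverse.filter p).length = (Finset.univ.filter fun w : Fin n => p w).card := by
  rw [← List.toFinset_card_of_nodup ((List.nodup_reverse.2 List.nodup_range).filter p)]
  refine (Finset.card_bij (fun (w : Fin n) _ => (w : ℕ)) ?_ ?_ ?_).symm
  · intro w hw
    simpa using hw
  · exact fun v _ w _ h => Fin.ext h
  · intro w hw
    simp only [List.mem_toFinset, List.mem_filter, List.mem_reverse, List.mem_range] at hw
    exact ⟨⟨w, hw.1⟩, by simpa using hw.2, rfl⟩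

/-- The positions in the preference lists `agentRow A n M V`. -/
theorem isLayout_agentRow (hM : n ∣ M) (hA : ∀ v, A v v = false)
    (hV : ∀ r < n, (V r).Nodup ∧ ∀ w, w ∈ V r ↔ w < n) :
    IsLayout (fun v w : Fin n => A v w) (fun (j : Fin M) (w : Fin n) => (V (j % n)).idxOf (w : ℕ))
      fun a b => ((agentRow A n M V (finSumFinEquiv a : Fin (n + M))).idxOf
        (finSumFinEquiv b : ℕ) : ℤ) := by
  have h := isPrefLists_agentRow (M := M) hM hA hV
  have hv : ∀ v : Fin n, agentRow A n M V v = vertexRow A n M v := fun v => if_pos v.2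
  have hd : ∀ j : Fin M, agentRow A n M V (n + j) = dummyRow n M (V (j % n)) j := by
    intro j
    simp [agentRow]
  have hVj : ∀ j : Fin M, (V (j % n)).Nodup ∧ ∀ w, w ∈ V (j % n) ↔ w < n :=
    fun j => hV _ (mod_lt_of_dvd hM j.2)
  have hlen : ∀ j : Fin M, (V (j % n)).length = n := by
    intro j
    have : (V (j % n)).toFinset = Finset.range n := by
      ext b
      simp [(hVj j).2]
    rw [← List.toFinset_card_of_nodup (hVj j).1, this, Finset.card_range]
  have hdeg : ∀ v : ℕ, ((List.range n).reverse.filter (A v)).length ≤ n := fun v =>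
    (List.length_filter_le _ _).trans (by simp)
  constructor
  · intro v w hvw
    simp only [finSumFinEquiv_apply_left, Fin.val_castAdd, hv]
    have hw : (w : ℕ) ∈ (List.range n).reverse.filter (A v) := by simpa using hvw
    have := List.idxOf_lt_length_iff.2 hw
    rw [vertexRow, List.append_assoc, List.idxOf_append_of_mem hw]
    have := hdeg v
    omega
  · intro v w hvw
    simp only [finSumFinEquiv_apply_left, Fin.val_castAdd, hv]
    have hw : (w : ℕ) ∉ (List.range n).reverse.filter (A v) ++ (List.range M).map (n + ·) := by
      simp only [List.mem_append, List.mem_filter, List.mem_map, hvw]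
      have := w.2
      rintro (h | ⟨k, -, h⟩)
      · simp at h
      · omega
    rw [vertexRow, List.idxOf_append_of_notMem hw]
    have hle := List.idxOf_le_length (a := (w : ℕ))
      (l := (List.range n).reverse.filter fun w => !A v w && w != v)
    have hlen : (vertexRow A n M v).length = n + M - 1 := by
      have := h.length (finSumFinEquiv (inl v))
      simpa [hv] using this
    rw [vertexRow, List.length_append] at hlen
    have hM : M ≤ ((List.range n).reverse.filter (A v) ++ (List.range M).map (n + ·)).length := by
      simp
    have := v.2
    omega
  · intro v i
    simp only [finSumFinEquiv_apply_left, finSumFinEquiv_apply_right, Fin.val_castAdd,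
      Fin.val_natAdd, hv]
    rw [vertexRow, List.idxOf_append_of_mem, List.idxOf_append_of_notMem,
      idxOf_map_range (add_right_injective _) i.2, length_filter_reverse_range]
    · simp
    · simp
    · simp
  · intro j w
    have hw : (w : ℕ) ∈ V (j % n) := ((hVj j).2 _).2 w.2
    simp only [finSumFinEquiv_apply_left, finSumFinEquiv_apply_right, Fin.val_castAdd,
      Fin.val_natAdd, hd, dummyRow]
    cases isTop n j
    · rw [cond_false, List.idxOf_append_of_notMem, length_otherDummies j.2]
      · have := j.2
        simp
        omega
      · rw [mem_otherDummies j.2]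
        have := w.2
        omega
    · rw [cond_true, List.idxOf_append_of_mem hw]
      simp
  · intro j i hij
    have hij : (j : ℕ) ≠ i := fun e => hij (Fin.ext e)
    simp only [finSumFinEquiv_apply_right, Fin.val_natAdd, hd, dummyRow]
    have hw : n + (i : ℕ) ∉ V (j % n) := by
      rw [(hVj j).2]
      omega
    cases isTop n j
    · rw [cond_false, List.idxOf_append_of_mem, idxOf_otherDummies i.2 hij]
      · simp
      · rw [mem_otherDummies j.2]
        have := i.2
        omega
    · rw [cond_true, List.idxOf_append_of_notMem hw, hlen, Nat.cast_add,
        idxOf_otherDummies i.2 hij]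
      simp
      ring
  · intro i
    rw [List.idxOf_of_notMem fun hm => (((h _ (finSumFinEquiv (inr i)).2).2 _).1 hm).2 rfl,
      h.length]
    have := i.2
    omega
  · intro j w
    exact (List.idxOf_lt_length_iff.2 (((hVj j).2 _).2 w.2)).trans_eq (hlen j)

theorem nodup_rotation {r : ℕ} : (rotation n r).Nodup := by
  rw [rotation, List.cons_append, List.nodup_cons]
  refine ⟨?_, (List.nodup_range.map (add_right_injective _)).append List.nodup_range ?_⟩
  · simp only [List.mem_append, List.mem_map, List.mem_range]
    rintro (⟨j, -, h⟩ | h) <;> omega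
  · simp only [List.disjoint_left, List.mem_map, List.mem_range]
    rintro w ⟨j, -, rfl⟩ h
    omega

theorem mem_rotation {r : ℕ} (hr : r < n) (w : ℕ) : w ∈ rotation n r ↔ w < n := by
  simp only [rotation, List.mem_cons, List.cons_append, List.mem_append, List.mem_map,
    List.mem_range]
  constructor
  · rintro (rfl | ⟨j, hj, rfl⟩ | h) <;> omega
  · intro h
    rcases lt_trichotomy w r with h' | h' | h'
    · exact .inr (.inr h')
    · exact .inl h'
    · exact .inr (.inl ⟨w - r - 1, by omega, by omega⟩)

theorem idxOf_rotation {r w : ℕ} (hr : r < n) (hw : w < n) :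
    (rotation n r).idxOf w = (w + (n - r)) % n := by
  rw [rotation, List.cons_append]
  rcases lt_trichotomy w r with h | rfl | h
  · rw [List.idxOf_cons_ne _ h.ne', List.idxOf_append_of_notMem, idxOf_range h, List.length_map,
      List.length_range, Nat.mod_eq_of_lt (by omega)]
    · omega
    · simp only [List.mem_map]
      rintro ⟨j, -, h⟩
      omega
  · rw [List.idxOf_cons_self, show w + (n - w) = n by omega, Nat.mod_self]
  · obtain ⟨j, rfl⟩ : ∃ j, w = r + 1 + j := ⟨w - r - 1, by omega⟩
    rw [List.idxOf_cons_ne _ h.ne, List.idxOf_append_of_mem,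
      idxOf_map_range (add_right_injective _) (by omega),
      show r + 1 + j + (n - r) = j + 1 + n by omega, Nat.add_mod_right, Nat.mod_eq_of_lt (by omega)]
    simp only [List.mem_map, List.mem_range]
    exact ⟨j, by omega, rfl⟩

end Rows

end StableRoommates

namespace StableRoommates

open Sum

/-! ### Correctness of the reduction -/

section

variable {A A' : ℕ → ℕ → Bool} {n : ℕ}

theorem isPrefLists_increasing (hA : ∀ v, A v v = false) :
    IsPrefLists (n + 3 * numCopies n * n)
      (agentRow A n (3 * numCopies n * n) fun _ => List.range n) :=
  isPrefLists_agentRow (dvd_mul_left _ _) hA fun _ _ => ⟨List.nodup_range, by simp⟩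

theorem isPrefLists_rotation (hA : ∀ v, A v v = false) :
    IsPrefLists (n + 3 * numCopies n * n) (agentRow A n (3 * numCopies n * n) (rotation n)) :=
  isPrefLists_agentRow (dvd_mul_left _ _) hA fun _ hr => ⟨nodup_rotation, mem_rotation hr⟩

theorem spearCost_permCongr {M : ℕ} {L L' : ℕ → List ℕ} (h : IsPrefLists (n + M) L)
    (h' : IsPrefLists (n + M) L') (σ : Equiv.Perm (Fin n ⊕ Fin M)) :
    (spearCost (ofLists h) (ofLists h') (finSumFinEquiv.permCongr σ) : ℤ) =
      cost (fun a b => ((L (finSumFinEquiv a : Fin (n + M))).idxOf (finSumFinEquiv b : ℕ) : ℤ))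
        (fun a b => ((L' (finSumFinEquiv a : Fin (n + M))).idxOf (finSumFinEquiv b : ℕ) : ℤ))
        σ := by
  rw [spearCost_ofLists, cost, ← finSumFinEquiv.sum_comp]
  refine Finset.sum_congr rfl fun a _ => ?_
  rw [← finSumFinEquiv.sum_comp]
  simp [Equiv.permCongr_apply]

/-- The graphs are isomorphic if and only if the distance of the two instances is below the
threshold. -/
theorem dSpear_lt_threshold_iff (hA : ∀ v, A v v = false) (hA' : ∀ v, A' v v = false) :
    dSpear (ofLists (isPrefLists_increasing (n := n) hA))
        (ofLists (isPrefLists_rotation (n := n) hA')) < threshold n ↔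
      ∃ α : Equiv.Perm (Fin n), ∀ v w : Fin n, A v w = A' (α v) (α w) := by
  have hM : n ∣ 3 * numCopies n * n := dvd_mul_left _ _
  have h := isLayout_agentRow (V := fun _ => List.range n) hM hA fun _ _ =>
    ⟨List.nodup_range, by simp⟩
  have h' := isLayout_agentRow (V := rotation n) hM hA' fun _ hr =>
    ⟨nodup_rotation, mem_rotation hr⟩
  rw [← exists_cost_lt_iff (s := numCopies n) rfl rfl h h' fun α => ?_]
  · have ht : ((threshold n : ℕ) : ℤ) = (numCopies n : ℕ) * n ^ 3 + 1 := by
      simp [threshold]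
    simp only [← spearCost_permCongr (isPrefLists_increasing hA) (isPrefLists_rotation hA'), ← ht,
      Nat.cast_lt]
    constructor
    · intro hlt
      obtain ⟨σ, hσ⟩ := exists_spearCost_eq_dSpear rfl
        (ofLists (isPrefLists_increasing (n := n) hA))
        (ofLists (isPrefLists_rotation (n := n) hA'))
      refine ⟨finSumFinEquiv.permCongr.symm σ, ?_⟩
      rwa [Equiv.apply_symm_apply, hσ]
    · rintro ⟨σ, hσ⟩
      exact (dSpear_le_spearCost _ _ _).trans_lt hσ
  · rw [← sum_rank_sub α]
    refine Finset.sum_congr rfl fun j _ => Finset.sum_congr rfl fun w _ => ?_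
    rw [idxOf_range w.2, idxOf_rotation (mod_lt_of_dvd hM j.2) (α w).2]

end

end StableRoommates

namespace StableRoommates

open Function

/-! ### The reduction in polynomial time -/

theorem length_flatMap_le {α : Type*} {l : List α} {f : α → List Bool} {c : ℕ}
    (h : ∀ a ∈ l, (f a).length ≤ c) : (l.flatMap f).length ≤ l.length * c := by
  induction l with
  | nil => simp
  | cons a l ih =>
    simp only [List.flatMap_cons, List.length_append, List.length_cons, Nat.succ_mul]
    have := h a (by simp)
    have := ih fun b hb => h b (by simp [hb])
    omega

theorem length_encode_ofLists_le {N : ℕ} {L : ℕ → List ℕ} (h : IsPrefLists N L) :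
    (ofLists h).encode.length ≤ N ^ 3 := by
  rw [encode_ofLists]
  refine (length_flatMap_le (c := N * N) fun a ha => ?_).trans_eq (by simp; ring)
  have ha := List.mem_range.1 ha
  refine (length_flatMap_le (c := N) fun b hb => ?_).trans ?_
  · have := ((h a ha).2 b).1 hb
    simp [unary]
    omega
  · have := h.length ⟨a, ha⟩
    simp only at this
    exact Nat.mul_le_mul_right _ (by omega)

theorem dSpear_ofLists_le {N : ℕ} {L L' : ℕ → List ℕ} (h : IsPrefLists N L)
    (h' : IsPrefLists N L') : dSpear (ofLists h) (ofLists h') ≤ N ^ 3 := by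
  refine (dSpear_le_spearCost _ _ 1).trans ?_
  rw [← Nat.cast_le (α := ℤ), spearCost_ofLists]
  calc _ ≤ ∑ a : Fin N, ∑ b : Fin N, (N : ℤ) := by
        refine Finset.sum_le_sum fun a _ => Finset.sum_le_sum fun b _ => ?_
        have h₁ := List.idxOf_le_length (a := (b : ℕ)) (l := L a)
        have h₂ := List.idxOf_le_length (a := (b : ℕ)) (l := L' a)
        rw [h.length] at h₁
        rw [h'.length] at h₂
        rw [Equiv.Perm.one_apply, Equiv.Perm.one_apply, abs_le]
        constructor <;> omega
    _ = ((N ^ 3 : ℕ) : ℤ) := by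
        simp
        ring

open Classical in
/-- The adjacency of a graph on `0, …, n - 1`, as a Boolean function on the natural numbers. -/
noncomputable def adjacency {n : ℕ} (G : SimpleGraph (Fin n)) (v w : ℕ) : Bool :=
  decide (∃ (hv : v < n) (hw : w < n), G.Adj ⟨v, hv⟩ ⟨w, hw⟩)

section

variable {n : ℕ} (G G' : SimpleGraph (Fin n))

theorem adjacency_self (v : ℕ) : adjacency G v v = false := by
  simp [adjacency]

open Classical in
theorem adjacency_coe (v w : Fin n) : adjacency G v w = decide (G.Adj v w) := by
  simp [adjacency]

theorem encodeGraph_eq : encodeGraph G = adjWord (adjacency G) n := by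
  classical
  rw [encodeGraph, adjWord, ← List.map_coe_finRange_eq_range, List.flatMap_map]
  refine List.flatMap_congr fun v _ => ?_
  rw [List.map_map]
  exact List.map_congr_left fun w _ => by simp [adjacency_coe]

theorem nonempty_iso_iff :
    Nonempty (G ≃g G') ↔ ∃ α : Equiv.Perm (Fin n), ∀ v w : Fin n,
      adjacency G v w = adjacency G' (α v) (α w) := by
  simp only [adjacency_coe, decide_eq_decide]
  exact ⟨fun ⟨f⟩ => ⟨f.toEquiv, fun v w => f.map_rel_iff.symm⟩,
    fun ⟨α, h⟩ => ⟨⟨α, fun {v w} => (h v w).symm⟩⟩⟩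

end

/-- The pair of instances that the reduction assigns to a pair of graphs. -/
noncomputable def instancePair (p : GraphPair) : SRPair where
  n := p.n + 3 * numCopies p.n * p.n
  even_n := by
    refine ⟨p.n * (3 * p.n ^ 2 + 2), ?_⟩
    rw [numCopies]
    ring
  I := ofLists (isPrefLists_increasing (adjacency_self p.G))
  I' := ofLists (isPrefLists_rotation (adjacency_self p.G'))

theorem encode_instancePair (p : GraphPair) :
    (instancePair p).encode = unary (p.n + 3 * numCopies p.n * p.n) ++
      instanceWord (adjacency p.G) p.n (3 * numCopies p.n * p.n) (fun _ => List.range p.n) ++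
      instanceWord (adjacency p.G') p.n (3 * numCopies p.n * p.n) (rotation p.n) := by
  rw [SRPair.encode]
  simp only [instancePair, encode_ofLists]
  rfl

theorem isomorphic_eq (p : GraphPair) :
    p.isomorphic = decide ((instancePair p).distance < threshold p.n) := by
  rw [GraphPair.isomorphic, decide_eq_decide, nonempty_iso_iff]
  exact (dSpear_lt_threshold_iff (adjacency_self p.G) (adjacency_self p.G')).symm

theorem graphIsomorphismInP_of_dSpearInPolyTime (h : DSpearInPolyTime) : GraphIsomorphismInP := by
  -- `q` is the number `N` of agents.  The distance and the lengths of the codes of the instances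
  -- are at most `N ^ 3`.
  let q : Polynomial ℕ := 6 * .X ^ 3 + 4 * .X
  refine polyTimeComputable_of_runs h isoCmd .inp .out (.X + q + 1 + 2 * q ^ 3) fun p => ?_
  have hn : p.n ≤ p.encode.length := by
    simp [GraphPair.encode, unary]
  have hq : p.n + 3 * numCopies p.n * p.n = q.eval p.n := by
    simp [q, numCopies]
    ring
  have hmono := eval_mono q hn
  have hmono3 := Nat.pow_le_pow_left hmono 3
  have hB : (Polynomial.X + q + 1 + 2 * q ^ 3).eval p.encode.length =
      p.encode.length + q.eval p.encode.length + 1 + 2 * q.eval p.encode.length ^ 3 := by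
    simp
  have hp : p.encode =
      unary p.n ++ adjWord (adjacency p.G) p.n ++ adjWord (adjacency p.G') p.n := by
    rw [GraphPair.encode, encodeGraph_eq, encodeGraph_eq]
  rw [isomorphic_eq]
  rw [hB]
  generalize q.eval p.encode.length = m at *
  rw [hp]
  refine runs_isoCmd (adjacency_self _) (adjacency_self _)
    ⟨instancePair p, (encode_instancePair p).symm, rfl⟩ ?_ ?_ ?_ ?_
  · rw [← hp]
    omega
  · rw [← encode_instancePair, SRPair.encode, List.length_append, List.length_append]
    have h₁ : (instancePair p).I.encode.length ≤ _ :=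
      length_encode_ofLists_le (isPrefLists_increasing (adjacency_self p.G))
    have h₂ : (instancePair p).I'.encode.length ≤ _ :=
      length_encode_ofLists_le (isPrefLists_rotation (adjacency_self p.G'))
    have h₃ : (unary (instancePair p).n).length = p.n + 3 * numCopies p.n * p.n + 1 := by
      simp [unary, instancePair]
    rw [hq] at h₁ h₂ h₃
    omega
  · have h₁ : (instancePair p).distance ≤ _ :=
      dSpear_ofLists_le (isPrefLists_increasing (adjacency_self p.G))
        (isPrefLists_rotation (adjacency_self p.G'))
    rw [hq] at h₁
    omega
  · have : threshold p.n ≤ q.eval p.n ^ 3 + 1 := by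
      rw [← hq, threshold]
      refine Nat.add_le_add_right ?_ 1
      calc numCopies p.n * p.n ^ 3 ≤ numCopies p.n ^ 3 * p.n ^ 3 :=
            Nat.mul_le_mul_right _ (Nat.le_self_pow (by decide) _)
        _ = (numCopies p.n * p.n) ^ 3 := (mul_pow ..).symm
        _ ≤ _ := Nat.pow_le_pow_left (by rw [mul_assoc]; omega) 3
    omega

end StableRoommates

/-- There is no polynomial-time algorithm to compute `d_spear`, unless Graph Isomorphism
is in P. -/
theorem mainTheorem2 (hGI : ¬ StableRoommates.GraphIsomorphismInP) :
    ¬ StableRoommates.DSpearInPolyTime :=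
  fun h => hGI (StableRoommates.graphIsomorphismInP_of_dSpearInPolyTime h)
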